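/- **Proposition 4.1.** Let $(M,P\nabla_M)$ be a compact projective manifold of dimension $n$, i.e. a compact Hausdorff smooth $n$-manifold with a $(\mathbb{R}P^n,PGL(n+1,\mathbb{R}))$-structure: an open cover by the domains of charts, each a diffeomorphism onto an open subset of $\mathbb{R}P^n$, whose coordinate changes are locally restrictions of elements of $PGL(n+1,\mathbb{R})$. Call a smooth map between projective manifolds of dimensions $p$ and $n$ a projective morphism if in projective charts it is locally induced by an injective linear map $\mathbb{R}^{p+1}\to\mathbb{R}^{n+1}$. Let $Aut(M,P\nabla_M)_0$ be the identity component, for the compact-open topology, of the group $Aut(M,P\nabla_M)$ of diffeomorphisms $f$ of $M$ such that $f$ and $f^{-1}$ are projective morphisms. Then: 1. Every orbit of $Aut(M,P\nabla_M)_0$ on $M$ is an immersed projective submanifold: it is the image of an injective smooth immersion $i:F\to M$, where $F$ is a connected, Hausdorff, second countable smooth manifold of some dimension $p$ that carries a projective structure for which $i$ is a projective morphism. 2. With these immersed structures the orbits are the leaves of a singular foliation of $M$ in the sense of Stefan and Sussmann: they partition $M$ into connected immersed submanifolds (whose dimensions may vary), and every vector tangent to an orbit is the value at its base point of a smooth vector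 field on $M$ that is everywhere tangent to the orbits. -/

import Mathlib

open Set Filter Topology
open scoped Manifold ContDiff LinearAlgebra.Projectivization

noncomputable section

/-! ## Real projective space as a smooth manifold -/

/-- The `n`-dimensional real projective space: lines through the origin of `ℝ ^ (n + 1)`. -/
abbrev RealProj (n : ℕ) : Type := ℙ ℝ (Fin (n + 1) → ℝ)

namespace RealProj

/-- The quotient topology coming from `ℝ ^ (n + 1) ∖ {0}`. -/
instance instTopology (n : ℕ) : TopologicalSpace (RealProj n) :=
  TopologicalSpace.coinduced (Projectivization.mk' ℝ) inferInstance

theorem isQuotientMap_mk' (n : ℕ) :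
    IsQuotientMap (Projectivization.mk' ℝ : {v : Fin (n + 1) → ℝ // v ≠ 0} → RealProj n) :=
  ⟨⟨rfl⟩, Quotient.mk_surjective⟩

/-- The homogeneous coordinates `(y₀, …, 1, …, yₙ₋₁)` with `1` in position `i`. -/
def homog {n : ℕ} (i : Fin (n + 1)) (y : EuclideanSpace ℝ (Fin n)) : Fin (n + 1) → ℝ :=
  i.insertNth (α := fun _ => ℝ) 1 (fun j => y j)

theorem homog_self {n : ℕ} (i : Fin (n + 1)) (y : EuclideanSpace ℝ (Fin n)) :
    homog i y i = 1 := by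
  simp [homog]

theorem homog_succAbove {n : ℕ} (i : Fin (n + 1)) (y : EuclideanSpace ℝ (Fin n)) (j : Fin n) :
    homog i y (i.succAbove j) = y j := by
  simp [homog]

theorem homog_ne_zero {n : ℕ} (i : Fin (n + 1)) (y : EuclideanSpace ℝ (Fin n)) :
    homog i y ≠ 0 := fun h => by
  have := homog_self i y
  rw [h] at this
  simp at this

theorem contDiff_homog {n : ℕ} (i k : Fin (n + 1)) :
    ContDiff ℝ ∞ (fun y : EuclideanSpace ℝ (Fin n) => homog i y k) := by
  rcases Fin.eq_self_or_eq_succAbove i k with rfl | ⟨j, rfl⟩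
  · simp only [homog_self]
    exact contDiff_const
  · simp only [homog_succAbove]
    fun_prop

/-- The affine coordinates `(xⱼ / xᵢ)`, `j ≠ i`, of a point of projective space. -/
def affCoord {n : ℕ} (i : Fin (n + 1)) : RealProj n → EuclideanSpace ℝ (Fin n) :=
  Projectivization.lift
    (fun v => WithLp.toLp 2 (fun j => (v : Fin (n + 1) → ℝ) (i.succAbove j) / (v : Fin (n + 1) → ℝ) i))
    (by
      rintro ⟨a, ha⟩ ⟨b, hb⟩ t h
      have ht : t ≠ 0 := by
        rintro rfl
        exact ha (by simpa using h)
      ext j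
      simp only at h
      simp [h, mul_div_mul_left _ _ ht])

theorem affCoord_mk {n : ℕ} (i : Fin (n + 1)) (v : Fin (n + 1) → ℝ) (hv : v ≠ 0) (j : Fin n) :
    affCoord i (Projectivization.mk ℝ v hv) j = v (i.succAbove j) / v i := rfl

/-- The open set of the points whose `i`-th homogeneous coordinate does not vanish. -/
def affDomain {n : ℕ} (i : Fin (n + 1)) : Set (RealProj n) := {p | p.rep i ≠ 0}

theorem mk_mem_affDomain {n : ℕ} (i : Fin (n + 1)) (v : Fin (n + 1) → ℝ) (hv : v ≠ 0) :
    Projectivization.mk ℝ v hv ∈ affDomain i ↔ v i ≠ 0 := by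
  obtain ⟨a, ha⟩ := Projectivization.exists_smul_eq_mk_rep ℝ v hv
  change (Projectivization.mk ℝ v hv).rep i ≠ 0 ↔ _
  rw [← ha]
  simp [Units.smul_def]

theorem isOpen_affDomain {n : ℕ} (i : Fin (n + 1)) : IsOpen (affDomain (n := n) i) := by
  rw [← (isQuotientMap_mk' n).isOpen_preimage]
  have : (Projectivization.mk' ℝ ⁻¹' affDomain i : Set {v : Fin (n + 1) → ℝ // v ≠ 0})
      = {v : {v : Fin (n + 1) → ℝ // v ≠ 0} | v.1 i ≠ 0} := by
    ext v
    exact mk_mem_affDomain i v.1 v.2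
  rw [this]
  exact isOpen_ne_fun ((continuous_apply i).comp continuous_subtype_val) continuous_const

/-- The standard affine chart of projective space on `{xᵢ ≠ 0}`. -/
def affChart {n : ℕ} (i : Fin (n + 1)) :
    OpenPartialHomeomorph (RealProj n) (EuclideanSpace ℝ (Fin n)) where
  toFun := affCoord i
  invFun y := Projectivization.mk ℝ (homog i y) (homog_ne_zero i y)
  source := affDomain i
  target := univ
  map_source' _ _ := mem_univ _
  map_target' y _ := by
    rw [mk_mem_affDomain, homog_self]
    exact one_ne_zero
  left_inv' p hp := by
    induction p using Projectivization.ind with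
    | h v hv =>
      have hi := (mk_mem_affDomain i v hv).1 hp
      rw [Projectivization.mk_eq_mk_iff']
      refine ⟨(v i)⁻¹, ?_⟩
      ext k
      rcases Fin.eq_self_or_eq_succAbove i k with rfl | ⟨j, rfl⟩
      · rw [homog_self]
        simp [hi]
      · rw [homog_succAbove, affCoord_mk]
        simp [div_eq_inv_mul]
  right_inv' y _ := by
    ext j
    rw [affCoord_mk, homog_self, homog_succAbove, div_one]
  open_source := isOpen_affDomain i
  open_target := isOpen_univ
  continuousOn_toFun := by
    rw [(isQuotientMap_mk' n).continuousOn_isOpen_iff (isOpen_affDomain i)]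
    have h : ContinuousOn (fun v : {v : Fin (n + 1) → ℝ // v ≠ 0} =>
        (WithLp.toLp 2 (fun j => (v : Fin (n + 1) → ℝ) (i.succAbove j) / (v : Fin (n + 1) → ℝ) i) :
          EuclideanSpace ℝ (Fin n))) (Projectivization.mk' ℝ ⁻¹' affDomain i) := by
      refine (PiLp.continuous_toLp 2 _).comp_continuousOn ?_
      refine continuousOn_pi.2 fun j => ContinuousOn.div
        ((continuous_apply _).comp continuous_subtype_val).continuousOn
        ((continuous_apply _).comp continuous_subtype_val).continuousOn ?_
      intro v hv
      exact (mk_mem_affDomain i v.1 v.2).1 hv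
    exact h
  continuousOn_invFun := by
    refine Continuous.continuousOn ?_
    refine (isQuotientMap_mk' n).continuous.comp (g := Projectivization.mk' ℝ)
      (f := fun y => ⟨homog i y, homog_ne_zero i y⟩) ?_
    exact Continuous.subtype_mk (continuous_pi fun k => (contDiff_homog i k).continuous) _

theorem exists_mem_affDomain {n : ℕ} (p : RealProj n) : ∃ i, p ∈ affDomain i := by
  by_contra! h
  exact p.rep_nonzero (funext fun i => not_not.1 (h i))

instance instChartedSpace (n : ℕ) : ChartedSpace (EuclideanSpace ℝ (Fin n)) (RealProj n) where
  atlas := range affChart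
  chartAt p := affChart (exists_mem_affDomain p).choose
  mem_chart_source p := (exists_mem_affDomain p).choose_spec
  chart_mem_atlas _ := mem_range_self _

instance instIsManifold (n : ℕ) : IsManifold (𝓡 n) ∞ (RealProj n) := by
  refine isManifold_of_contDiffOn (𝓡 n) ∞ (RealProj n) ?_
  rintro _ _ ⟨i, rfl⟩ ⟨j, rfl⟩
  simp only [modelWithCornersSelf_coe, modelWithCornersSelf_coe_symm, Function.id_comp,
    Function.comp_id, range_id, inter_univ, preimage_id_eq, id_eq]
  have h : ContDiffOn ℝ ∞ (fun y : EuclideanSpace ℝ (Fin n) =>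
      (WithLp.toLp 2 (fun k => homog i y (j.succAbove k) / homog i y j) :
        EuclideanSpace ℝ (Fin n))) {y | homog i y j ≠ 0} := by
    rw [contDiffOn_piLp]
    intro k
    exact ContDiffOn.div (contDiff_homog i _).contDiffOn (contDiff_homog i _).contDiffOn
      fun y hy => hy
  refine h.mono ?_
  intro y hy
  have h2 : Projectivization.mk ℝ (homog i y) (homog_ne_zero i y) ∈ affDomain j := hy.2
  exact (mk_mem_affDomain j _ _).1 h2

end RealProj

/-! ## Projective structures, projective maps, automorphisms -/

/-- A projective structure on a smooth `n`-manifold `M`, i.e. an `(ℝPⁿ, PGL(n + 1, ℝ))`-structure: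
an open cover of `M` by the domains of diffeomorphisms onto open subsets of `ℝPⁿ`, such that the
changes of charts are, locally, restrictions of elements of `PGL(n + 1, ℝ)` (that is, of the action
of elements of `GL(n + 1, ℝ)` on `ℝPⁿ`). -/
structure ProjectiveStructure (n : ℕ) (M : Type*) [TopologicalSpace M]
    [ChartedSpace (EuclideanSpace ℝ (Fin n)) M] where
  /-- the projective charts -/
  charts : Set (OpenPartialHomeomorph M (RealProj n))
  cover : ∀ x, ∃ e ∈ charts, x ∈ e.source
  contMDiffOn : ∀ e ∈ charts, ContMDiffOn (𝓡 n) (𝓡 n) ∞ e e.source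
  contMDiffOn_symm : ∀ e ∈ charts, ContMDiffOn (𝓡 n) (𝓡 n) ∞ e.symm e.target
  compat : ∀ e ∈ charts, ∀ e' ∈ charts, ∀ x ∈ e.source ∩ e'.source,
    ∃ g : (Fin (n + 1) → ℝ) ≃ₗ[ℝ] (Fin (n + 1) → ℝ),
      ∀ᶠ y in 𝓝 x, e' y = Projectivization.map g.toLinearMap g.injective (e y)

/-- A projective map (morphism of projective manifolds) from a `p`-dimensional to an
`n`-dimensional projective manifold: a smooth map which in projective charts is, locally, the map
`ℝPᵖ → ℝPⁿ` induced by an injective linear map `ℝ ^ (p + 1) → ℝ ^ (n + 1)`. -/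
structure IsProjectiveMap {p n : ℕ} {F M : Type*}
    [TopologicalSpace F] [ChartedSpace (EuclideanSpace ℝ (Fin p)) F]
    [TopologicalSpace M] [ChartedSpace (EuclideanSpace ℝ (Fin n)) M]
    (Q : ProjectiveStructure p F) (P : ProjectiveStructure n M) (f : F → M) : Prop where
  contMDiff : ContMDiff (𝓡 p) (𝓡 n) ∞ f
  eventually_eq : ∀ x, ∀ e ∈ Q.charts, x ∈ e.source → ∀ e' ∈ P.charts, f x ∈ e'.source →
    ∃ (L : (Fin (p + 1) → ℝ) →ₗ[ℝ] (Fin (n + 1) → ℝ)) (hL : Function.Injective L),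
      ∀ᶠ y in 𝓝 x, e' (f y) = Projectivization.map L hL (e y)

section

variable {m p n : ℕ} {E F M : Type*}
    [TopologicalSpace E] [ChartedSpace (EuclideanSpace ℝ (Fin m)) E]
    [TopologicalSpace F] [ChartedSpace (EuclideanSpace ℝ (Fin p)) F]
    [TopologicalSpace M] [ChartedSpace (EuclideanSpace ℝ (Fin n)) M]

theorem IsProjectiveMap.id (P : ProjectiveStructure n M) : IsProjectiveMap P P _root_.id where
  contMDiff := contMDiff_id
  eventually_eq x e he hx e' he' hx' := by
    obtain ⟨g, hg⟩ := P.compat e he e' he' x ⟨hx, hx'⟩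
    exact ⟨g.toLinearMap, g.injective, hg⟩

theorem IsProjectiveMap.comp {R : ProjectiveStructure m E} {Q : ProjectiveStructure p F}
    {P : ProjectiveStructure n M} {f : F → M} {g : E → F} (hf : IsProjectiveMap Q P f)
    (hg : IsProjectiveMap R Q g) : IsProjectiveMap R P (f ∘ g) where
  contMDiff := hf.contMDiff.comp hg.contMDiff
  eventually_eq x e he hx e' he' hx' := by
    obtain ⟨d, hd, hxd⟩ := Q.cover (g x)
    obtain ⟨L, hL, h1⟩ := hg.eventually_eq x e he hx d hd hxd
    obtain ⟨K, hK, h2⟩ := hf.eventually_eq (g x) d hd hxd e' he' hx'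
    refine ⟨K.comp L, hK.comp hL, ?_⟩
    filter_upwards [h1, hg.contMDiff.continuous.continuousAt.eventually h2] with y hy1 hy2
    rw [Function.comp_apply, hy2, hy1, Projectivization.map_comp L hL K hK]
    rfl

namespace ProjectiveStructure

/-- The group of automorphisms of a projective manifold. -/
def aut (P : ProjectiveStructure n M) : Subgroup (M ≃ₜ M) where
  carrier := {f | IsProjectiveMap P P f ∧ IsProjectiveMap P P f.symm}
  mul_mem' hf hg := ⟨hf.1.comp hg.1, hg.2.comp hf.2⟩
  one_mem' := ⟨IsProjectiveMap.id P, IsProjectiveMap.id P⟩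
  inv_mem' hf := ⟨hf.2, hf.1⟩

/-- An automorphism, as a continuous map. -/
def autToContinuousMap (P : ProjectiveStructure n M) (f : P.aut) : C(M, M) :=
  ⟨f.1, f.1.continuous⟩

/-- The automorphism group carries the compact-open topology. -/
instance autTopology (P : ProjectiveStructure n M) : TopologicalSpace P.aut :=
  TopologicalSpace.induced P.autToContinuousMap ContinuousMap.compactOpen

theorem continuous_mul_left_aut (P : ProjectiveStructure n M) (g : P.aut) :
    Continuous fun f : P.aut => g * f := by
  refine continuous_induced_rng.2 ?_
  exact Continuous.comp (g := (P.autToContinuousMap g).comp)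
    (ContinuousMap.continuous_postcomp (P.autToContinuousMap g))
    (continuous_induced_dom (f := P.autToContinuousMap))

theorem mul_mem_component (P : ProjectiveStructure n M) (g f h : P.aut)
    (hf : f ∈ connectedComponent (1 : P.aut)) (hh : h ∈ connectedComponent (1 : P.aut))
    (hgf : g * f ∈ connectedComponent (1 : P.aut)) :
    g * h ∈ connectedComponent (1 : P.aut) := by
  have hc : IsPreconnected ((fun k : P.aut => g * k) '' connectedComponent (1 : P.aut)) :=
    isPreconnected_connectedComponent.image _ (P.continuous_mul_left_aut g).continuousOn
  have := hc.subset_connectedComponent (mem_image_of_mem _ hf)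
  rw [connectedComponent_eq hgf]
  exact this (mem_image_of_mem _ hh)

/-- The identity component of the automorphism group. -/
def autZero (P : ProjectiveStructure n M) : Subgroup P.aut where
  carrier := connectedComponent 1
  mul_mem' {f g} hf hg :=
    P.mul_mem_component f 1 g mem_connectedComponent hg (by rwa [mul_one])
  one_mem' := mem_connectedComponent
  inv_mem' {f} hf := by
    have := P.mul_mem_component f⁻¹ f 1 hf mem_connectedComponent
      (by rw [inv_mul_cancel]; exact mem_connectedComponent)
    rwa [mul_one] at this

/-- The orbit of `x` under the identity component of the automorphism group. -/
def orbit (P : ProjectiveStructure n M) (x : M) : Set M :=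
  {y | ∃ g ∈ P.autZero, (g : M ≃ₜ M) x = y}

end ProjectiveStructure

end

/-! ## Immersed submanifolds and singular foliations -/

universe u

/-- An immersed submanifold of a smooth `n`-manifold `M`: a smooth manifold (Hausdorff and second
countable) of some dimension with an injective smooth immersion into `M`. -/
structure ImmersedSubmanifold (n : ℕ) (M : Type u) [TopologicalSpace M]
    [ChartedSpace (EuclideanSpace ℝ (Fin n)) M] where
  /-- the dimension -/
  dim : ℕ
  /-- the underlying abstract manifold -/
  Carrier : Type u
  [topology : TopologicalSpace Carrier]
  [t2 : T2Space Carrier]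
  [secondCountable : SecondCountableTopology Carrier]
  [chartedSpace : ChartedSpace (EuclideanSpace ℝ (Fin dim)) Carrier]
  [isManifold : IsManifold (𝓡 dim) ∞ Carrier]
  /-- the inclusion -/
  incl : Carrier → M
  injective : Function.Injective incl
  isImmersion : Manifold.IsImmersion (𝓡 dim) (𝓡 n) ∞ incl

attribute [instance] ImmersedSubmanifold.topology ImmersedSubmanifold.t2
  ImmersedSubmanifold.secondCountable ImmersedSubmanifold.chartedSpace
  ImmersedSubmanifold.isManifold

namespace ImmersedSubmanifold

variable {n : ℕ} {M : Type*} [TopologicalSpace M] [ChartedSpace (EuclideanSpace ℝ (Fin n)) M]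

/-- The subset of `M` underlying an immersed submanifold. -/
def support (S : ImmersedSubmanifold n M) : Set M := range S.incl

/-- An immersed submanifold is an immersed projective submanifold of `(M, P)` if it has a
projective structure for which the inclusion is a morphism of projective manifolds. -/
def IsProjective (S : ImmersedSubmanifold n M) (P : ProjectiveStructure n M) : Prop :=
  ∃ Q : ProjectiveStructure S.dim S.Carrier, IsProjectiveMap Q P S.incl

end ImmersedSubmanifold

/-- A singular foliation (in the sense of Stefan and Sussmann) of a smooth manifold `M`: a partition
of `M` into connected immersed submanifolds, the leaves, whose dimension may vary, such that every
vector tangent to a leaf is the value of a smooth vector field on `M` which is everywhere tangent to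
the leaves. -/
structure SingularFoliation (n : ℕ) (M : Type*) [TopologicalSpace M]
    [ChartedSpace (EuclideanSpace ℝ (Fin n)) M] [IsManifold (𝓡 n) ∞ M] where
  leaves : Set (ImmersedSubmanifold n M)
  connected : ∀ S ∈ leaves, ConnectedSpace S.Carrier
  cover : ∀ x, ∃ S ∈ leaves, x ∈ S.support
  disjoint : leaves.PairwiseDisjoint ImmersedSubmanifold.support
  exists_vectorField : ∀ S ∈ leaves, ∀ (y : S.Carrier) (w : TangentSpace (𝓡 S.dim) y),
    ∃ X : (x : M) → TangentSpace (𝓡 n) x,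
      ContMDiff (𝓡 n) (𝓡 n).tangent ∞ (fun x => (⟨x, X x⟩ : TangentBundle (𝓡 n) M)) ∧
      (∀ T ∈ leaves, ∀ z : T.Carrier,
        X (T.incl z) ∈ range (mfderiv (𝓡 T.dim) (𝓡 n) T.incl z)) ∧
      X (S.incl y) = mfderiv (𝓡 S.dim) (𝓡 n) S.incl y w

end

/-!
# Orbits of the automorphism group of a compact projective manifold

The projective vector fields of a projective manifold are the sections, modulo scalars, of a flat
bundle whose fibre is not only a Lie algebra but the associative algebra of endomorphisms of
`ℝ ^ (n + 1)`. On a compact manifold, covered by finitely many connected open sets contained in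
charts (`GoodCover`), the global sections form a finite dimensional algebra `GoodCover.symAlg`: the
families of endomorphisms, one for each chart, which are intertwined by the changes of charts.
Since this is an algebra, a section `a` close to `1` need not be exponentiated: it acts itself,
linearly in each chart, and defines an automorphism `GoodCover.toMap` of the manifold, in the
identity component (`GoodCover.eventually_exists_autZero`). Conversely every automorphism close to
the identity arises in this way from a section close to `1`
(`GoodCover.eventually_exists_eq_toMap`): its linear representatives in the charts, scaled to have
the trace of the identity, are intertwined by the changes of charts.

Hence, in a chart, the orbit of the line spanned by a vector `v` is near this line the projective
subspace of the lines in the linear subspace `{a v}` of the values of the sections at `v`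
(`GoodCover.orbitSpace`, `GoodCover.eventually_exists_toMap_eq`). The dimension of this subspace is
constant on an orbit because it is locally constant on the automorphism group
(`GoodCover.rank_eq_of_mem_orbit`). So an orbit is a union of plaques which are pieces of projective
subspaces in the charts, any two of which agree near their common points. The plaques are the
charts of an immersed manifold (`PlaqueFamily.Leaf`), whose projective structure comes from the
linear parametrizations of the subspaces (`GoodCover.orbitProjectiveStructure`). The orbit map from
the identity component to the leaf is continuous for the leaf topology and surjective, so the leaf
is connected and second countable.

Finally, the vectors tangent to the orbit at `v` are the velocities at `s = 0` of the curves
`(1 + s a) v`. With `s` replaced by a bounded function `ψ s` with `ψ 0 = 0` and `ψ' 0 = 1`, these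
curves are defined for all `s` and all points of the manifold, and their velocities form a smooth
vector field tangent to the orbits (`GoodCover.SymmetryCurve.field`).
-/

noncomputable section

universe u

/-! ### The linear action on projective space -/

namespace RealProj

variable {p n : ℕ}

/-- The line spanned by a vector. It is a total function on `ℝ ^ (n + 1)`, whose value at `0` is
a junk value. -/
def proj (v : Fin (n + 1) → ℝ) : RealProj n :=
  if h : v ≠ 0 then Projectivization.mk ℝ v h
  else Projectivization.mk ℝ (homog 0 0) (homog_ne_zero 0 0)

theorem proj_of_ne_zero {v : Fin (n + 1) → ℝ} (h : v ≠ 0) : proj v = Projectivization.mk ℝ v h :=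
  dif_pos h

@[simp]
theorem proj_rep (x : RealProj n) : proj x.rep = x := by
  rw [proj_of_ne_zero x.rep_nonzero, Projectivization.mk_rep]

theorem proj_smul {c : ℝ} (hc : c ≠ 0) (v : Fin (n + 1) → ℝ) : proj (c • v) = proj v := by
  by_cases hv : v = 0
  · simp [hv]
  · rw [proj_of_ne_zero hv, proj_of_ne_zero (smul_ne_zero hc hv), Projectivization.mk_eq_mk_iff']
    exact ⟨c, rfl⟩

theorem proj_eq_proj_iff {v w : Fin (n + 1) → ℝ} (hv : v ≠ 0) (hw : w ≠ 0) :
    proj v = proj w ↔ ∃ c : ℝ, c ≠ 0 ∧ v = c • w := by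
  rw [proj_of_ne_zero hv, proj_of_ne_zero hw, Projectivization.mk_eq_mk_iff']
  constructor
  · rintro ⟨c, rfl⟩
    exact ⟨c, fun h => hv (by simp [h]), rfl⟩
  · rintro ⟨c, -, rfl⟩
    exact ⟨c, rfl⟩

theorem exists_rep_proj {v : Fin (n + 1) → ℝ} (hv : v ≠ 0) :
    ∃ c : ℝ, c ≠ 0 ∧ (proj v).rep = c • v := by
  rw [← proj_eq_proj_iff (proj v).rep_nonzero hv, proj_rep]

theorem proj_mem_affDomain {i : Fin (n + 1)} {v : Fin (n + 1) → ℝ} (hv : v i ≠ 0) :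
    proj v ∈ affDomain i := by
  have h : v ≠ 0 := fun h => hv (by simp [h])
  rw [proj_of_ne_zero h]
  exact (mk_mem_affDomain i v h).2 hv

theorem apply_ne_zero {L : (Fin (p + 1) → ℝ) →ₗ[ℝ] (Fin (n + 1) → ℝ)}
    (hL : Function.Injective L) {v : Fin (p + 1) → ℝ} (hv : v ≠ 0) : L v ≠ 0 :=
  (map_ne_zero_iff L hL).2 hv

/-- The map of projective spaces induced by a linear map; a junk value where the linear map
vanishes. -/
def act (L : (Fin (p + 1) → ℝ) →ₗ[ℝ] (Fin (n + 1) → ℝ)) (x : RealProj p) : RealProj n :=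
  proj (L x.rep)

theorem act_proj (L : (Fin (p + 1) → ℝ) →ₗ[ℝ] (Fin (n + 1) → ℝ)) {v : Fin (p + 1) → ℝ}
    (hv : v ≠ 0) : act L (proj v) = proj (L v) := by
  obtain ⟨c, hc, h⟩ := exists_rep_proj hv
  rw [act, h, map_smul, proj_smul hc]

theorem map_eq_act (L : (Fin (p + 1) → ℝ) →ₗ[ℝ] (Fin (n + 1) → ℝ)) (hL : Function.Injective L)
    (x : RealProj p) : Projectivization.map L hL x = act L x := by
  rw [act, proj_of_ne_zero (apply_ne_zero hL x.rep_nonzero)]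
  conv_lhs => rw [← x.mk_rep]
  rfl

theorem act_comp {m : ℕ} (K : (Fin (n + 1) → ℝ) →ₗ[ℝ] (Fin (m + 1) → ℝ))
    (L : (Fin (p + 1) → ℝ) →ₗ[ℝ] (Fin (n + 1) → ℝ)) {x : RealProj p} (hx : L x.rep ≠ 0) :
    act (K ∘ₗ L) x = act K (act L x) := by
  rw [act.eq_1 L, act_proj K hx]
  rfl

theorem act_comp_of_injective {m : ℕ} (K : (Fin (n + 1) → ℝ) →ₗ[ℝ] (Fin (m + 1) → ℝ))
    {L : (Fin (p + 1) → ℝ) →ₗ[ℝ] (Fin (n + 1) → ℝ)} (hL : Function.Injective L)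
    (x : RealProj p) : act (K ∘ₗ L) x = act K (act L x) :=
  act_comp K L (apply_ne_zero hL x.rep_nonzero)

@[simp]
theorem act_id (x : RealProj n) : act LinearMap.id x = x := by
  simp [act]

@[simp]
theorem act_one (x : RealProj n) : act 1 x = x := by
  simp [act]

theorem act_smul {c : ℝ} (hc : c ≠ 0) (L : (Fin (p + 1) → ℝ) →ₗ[ℝ] (Fin (n + 1) → ℝ))
    (x : RealProj p) : act (c • L) x = act L x := by
  rw [act, LinearMap.smul_apply, proj_smul hc, act]

theorem act_injective {L : (Fin (p + 1) → ℝ) →ₗ[ℝ] (Fin (n + 1) → ℝ)}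
    (hL : Function.Injective L) : Function.Injective (act L) := by
  intro x y h
  rw [← map_eq_act L hL, ← map_eq_act L hL] at h
  exact Projectivization.map_injective L hL h

theorem affChart_mem_maximalAtlas (i : Fin (n + 1)) :
    affChart i ∈ IsManifold.maximalAtlas (𝓡 n) ∞ (RealProj n) :=
  IsManifold.subset_maximalAtlas (mem_range_self i)

theorem contMDiffAt_proj {v : Fin (n + 1) → ℝ} (hv : v ≠ 0) :
    ContMDiffAt 𝓘(ℝ, Fin (n + 1) → ℝ) (𝓡 n) ∞ proj v := by
  obtain ⟨i, hi⟩ : ∃ i, v i ≠ 0 := by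
    by_contra! h
    exact hv (funext h)
  have h1 : ContDiffAt ℝ ∞ (fun w : Fin (n + 1) → ℝ =>
      (WithLp.toLp 2 (fun j => w (i.succAbove j) / w i) : EuclideanSpace ℝ (Fin n))) v := by
    rw [contDiffAt_piLp]
    intro j
    exact ContDiffAt.div (contDiff_apply ℝ ℝ _).contDiffAt (contDiff_apply ℝ ℝ _).contDiffAt hi
  have h2 : ContMDiffAt 𝓘(ℝ, Fin (n + 1) → ℝ) (𝓡 n) ∞ ((affChart i).symm ∘
      fun w : Fin (n + 1) → ℝ =>
      (WithLp.toLp 2 (fun j => w (i.succAbove j) / w i) : EuclideanSpace ℝ (Fin n))) v :=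
    (contMDiffAt_symm_of_mem_maximalAtlas (affChart_mem_maximalAtlas i) (mem_univ _)).comp v
      h1.contMDiffAt
  refine h2.congr_of_eventuallyEq ?_
  have h3 : ∀ᶠ w : Fin (n + 1) → ℝ in 𝓝 v, w i ≠ 0 :=
    (continuous_apply i).continuousAt.eventually_ne hi
  filter_upwards [h3] with w hw
  have hw0 : w ≠ 0 := fun h => hw (by simp [h])
  have h4 := (affChart i).left_inv (proj_mem_affDomain hw)
  rw [← h4, Function.comp_apply]
  congr 1
  rw [proj_of_ne_zero hw0]
  ext j
  exact affCoord_mk i w hw0 j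

/-- A local section of the projection `ℝ ^ (n + 1) ∖ {0} → ℝPⁿ` over the affine domain `xᵢ ≠ 0`. -/
def lift (i : Fin (n + 1)) (x : RealProj n) : Fin (n + 1) → ℝ := homog i (affCoord i x)

theorem lift_ne_zero (i : Fin (n + 1)) (x : RealProj n) : lift i x ≠ 0 := homog_ne_zero _ _

theorem proj_lift {i : Fin (n + 1)} {x : RealProj n} (hx : x ∈ affDomain i) :
    proj (lift i x) = x := by
  rw [proj_of_ne_zero (lift_ne_zero i x)]
  exact (affChart i).left_inv hx

theorem contMDiffAt_lift {i : Fin (n + 1)} {x : RealProj n} (hx : x ∈ affDomain i) :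
    ContMDiffAt (𝓡 n) 𝓘(ℝ, Fin (n + 1) → ℝ) ∞ (lift i) x := by
  have h : ContDiff ℝ ∞ (homog (n := n) i) := contDiff_pi.2 fun k => contDiff_homog i k
  exact h.contMDiff.contMDiffAt.comp x
    (contMDiffAt_of_mem_maximalAtlas (affChart_mem_maximalAtlas i) hx)

theorem act_eq_proj_lift (L : (Fin (p + 1) → ℝ) →ₗ[ℝ] (Fin (n + 1) → ℝ)) {i : Fin (p + 1)}
    {x : RealProj p} (hx : x ∈ affDomain i) : act L x = proj (L (lift i x)) := by
  conv_lhs => rw [← proj_lift hx]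
  exact act_proj L (lift_ne_zero i x)

theorem apply_lift_ne_zero {L : (Fin (p + 1) → ℝ) →ₗ[ℝ] (Fin (n + 1) → ℝ)} {i : Fin (p + 1)}
    {x : RealProj p} (hx : x ∈ affDomain i) (hL : L x.rep ≠ 0) : L (lift i x) ≠ 0 := by
  obtain ⟨c, hc, h⟩ := exists_rep_proj (lift_ne_zero i x)
  rw [proj_lift hx] at h
  rw [h, map_smul] at hL
  exact (smul_ne_zero_iff.1 hL).2

section

variable {E H N : Type*} [NormedAddCommGroup E] [NormedSpace ℝ E] [TopologicalSpace H]
  {I : ModelWithCorners ℝ E H} [TopologicalSpace N] [ChartedSpace H N]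

theorem contMDiffAt_act {u : N → (Fin (p + 1) → ℝ) →L[ℝ] (Fin (n + 1) → ℝ)} {h : N → RealProj p}
    {x : N} (hu : ContMDiffAt I 𝓘(ℝ, (Fin (p + 1) → ℝ) →L[ℝ] (Fin (n + 1) → ℝ)) ∞ u x)
    (hh : ContMDiffAt I (𝓡 p) ∞ h x) (hx : u x (h x).rep ≠ 0) :
    ContMDiffAt I (𝓡 n) ∞ (fun y => act (u y : (Fin (p + 1) → ℝ) →ₗ[ℝ] (Fin (n + 1) → ℝ)) (h y))
      x := by
  obtain ⟨i, hi⟩ := exists_mem_affDomain (h x)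
  have h1 : ContMDiffAt I 𝓘(ℝ, Fin (n + 1) → ℝ) ∞ (fun y => u y (lift i (h y))) x :=
    hu.clm_apply ((contMDiffAt_lift hi).comp x hh)
  have h2 : ContMDiffAt I (𝓡 n) ∞ (fun y => proj (u y (lift i (h y)))) x :=
    ContMDiffAt.comp x (g := proj) (contMDiffAt_proj (apply_lift_ne_zero
      (L := (u x : (Fin (p + 1) → ℝ) →ₗ[ℝ] (Fin (n + 1) → ℝ))) hi hx)) h1
  refine h2.congr_of_eventuallyEq ?_
  filter_upwards [hh.continuousAt.eventually ((isOpen_affDomain i).mem_nhds hi)] with y hy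
  exact act_eq_proj_lift _ hy

theorem contMDiffAt_act_const {L : (Fin (p + 1) → ℝ) →ₗ[ℝ] (Fin (n + 1) → ℝ)} {h : N → RealProj p}
    {x : N} (hh : ContMDiffAt I (𝓡 p) ∞ h x) (hx : L (h x).rep ≠ 0) :
    ContMDiffAt I (𝓡 n) ∞ (fun y => act L (h y)) x :=
  contMDiffAt_act (u := fun _ => L.toContinuousLinearMap) contMDiffAt_const hh hx

end

/-! ### Linear maps inducing the same projective map -/

/-- A linear map `K` with `K v` collinear to `L v` for all `v` in a nonempty open set is a multiple
of the injective endomorphism `L`: the quadratic equations `(L v)ᵢ (K v)ⱼ = (L v)ⱼ (K v)ᵢ`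
propagate from the open set to all vectors. -/
theorem exists_eq_smul_of_eventually_collinear {L K : (Fin (n + 1) → ℝ) →ₗ[ℝ] (Fin (n + 1) → ℝ)}
    (hL : Function.Injective L) {v : Fin (n + 1) → ℝ}
    (h : ∀ᶠ w in 𝓝 v, ∀ i j, L w i * K w j = L w j * K w i) : ∃ c : ℝ, K = c • L := by
  have h1 : ∀ w i j, L w i * K w j = L w j * K w i := by
    intro w i j
    have ht : Tendsto (fun t : ℝ => v + t • w) (𝓝 0) (𝓝 v) := by
      have : Continuous fun t : ℝ => v + t • w := by fun_prop
      simpa using this.tendsto 0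
    have ht' : Tendsto (fun t : ℝ => v - t • w) (𝓝 0) (𝓝 v) := by
      have : Continuous fun t : ℝ => v - t • w := by fun_prop
      simpa using this.tendsto 0
    have h2 : ∀ᶠ t : ℝ in 𝓝[≠] 0, t ≠ 0 := eventually_mem_nhdsWithin
    obtain ⟨t, ha, hb, ht0⟩ := (((ht.eventually h).filter_mono nhdsWithin_le_nhds).and
      (((ht'.eventually h).filter_mono nhdsWithin_le_nhds).and h2)).exists
    have h0 := h.self_of_nhds i j
    have ha := ha i j
    have hb := hb i j
    simp only [map_add, map_sub, map_smul, Pi.add_apply, Pi.sub_apply, Pi.smul_apply,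
      smul_eq_mul] at ha hb
    have h3 : t ^ 2 * (L w i * K w j) = t ^ 2 * (L w j * K w i) := by linarith
    exact mul_left_cancel₀ (pow_ne_zero 2 ht0) h3
  let e := LinearEquiv.ofInjectiveEndo L hL
  have he : ∀ w, L (e.symm w) = w := fun w => e.apply_symm_apply w
  obtain ⟨c, hc⟩ := LinearMap.exists_eq_smul_id_of_forall_notLinearIndependent
    (f := K ∘ₗ e.symm.toLinearMap) (fun w hw => by
      rw [LinearIndependent.pair_iff] at hw
      by_cases hw0 : w = 0
      · have := hw 1 0 (by simp [hw0])
        simp at this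
      · obtain ⟨i, hi⟩ : ∃ i, w i ≠ 0 := by
          by_contra! h
          exact hw0 (funext h)
        have := hw (K (e.symm w) i) (-(w i)) (by
          ext j
          have := h1 (e.symm w) i j
          rw [he] at this
          simp only [LinearMap.comp_apply, Pi.add_apply, Pi.smul_apply, smul_eq_mul, Pi.zero_apply,
            LinearEquiv.coe_coe]
          linarith)
        exact hi (by simpa using this.2))
  refine ⟨c, LinearMap.ext fun w => ?_⟩
  have := LinearMap.congr_fun hc (L w)
  have h4 : e.symm (L w) = w := e.symm_apply_apply w
  simpa [h4] using this

theorem collinear_of_proj_eq {v w : Fin (n + 1) → ℝ} (hv : v ≠ 0) (hw : w ≠ 0)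
    (h : proj v = proj w) (i j : Fin (n + 1)) : v i * w j = v j * w i := by
  obtain ⟨c, -, rfl⟩ := (proj_eq_proj_iff hv hw).1 h
  simp only [Pi.smul_apply, smul_eq_mul]
  ring

/-- An injective linear endomorphism is determined, up to a factor, by the germ of the projective
map that it induces. -/
theorem exists_eq_smul_of_act_eventuallyEq {L K : (Fin (n + 1) → ℝ) →ₗ[ℝ] (Fin (n + 1) → ℝ)}
    (hL : Function.Injective L) (hK : Function.Injective K) {x : RealProj n}
    (h : ∀ᶠ y in 𝓝 x, act L y = act K y) : ∃ c : ℝ, c ≠ 0 ∧ K = c • L := by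
  have h1 : ∀ᶠ w in 𝓝 x.rep, act L (proj w) = act K (proj w) := by
    have := (contMDiffAt_proj x.rep_nonzero).continuousAt
    rw [ContinuousAt, proj_rep] at this
    exact this.eventually h
  obtain ⟨c, hc⟩ := exists_eq_smul_of_eventually_collinear (K := K) hL (v := x.rep) (by
    filter_upwards [h1, continuousAt_id.eventually_ne x.rep_nonzero] with w hw (hw0 : w ≠ 0) i j
    rw [act_proj _ hw0, act_proj _ hw0] at hw
    exact collinear_of_proj_eq (apply_ne_zero hL hw0) (apply_ne_zero hK hw0) hw i j)
  refine ⟨c, ?_, hc⟩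
  rintro rfl
  exact apply_ne_zero hK x.rep_nonzero (by simp [hc])

/-- Two linear maps that induce the same projective map in a projective chart near a point are
proportional. -/
theorem exists_eq_smul_of_chart_eventuallyEq {M : Type*} [TopologicalSpace M]
    {e : OpenPartialHomeomorph M (RealProj n)} {x : M} (hx : x ∈ e.source)
    {L K : (Fin (n + 1) → ℝ) →ₗ[ℝ] (Fin (n + 1) → ℝ)}
    (hL : Function.Injective L) (hK : Function.Injective K)
    (h : ∀ᶠ y in 𝓝 x, act L (e y) = act K (e y)) : ∃ c : ℝ, c ≠ 0 ∧ K = c • L := by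
  refine exists_eq_smul_of_act_eventuallyEq hL hK (x := e x) ?_
  rw [← e.map_nhds_eq hx]
  exact h

end RealProj

namespace RealProj

/-! ### Affine charts adapted to a projective subspace -/

variable {n p q : ℕ}

theorem rep_proj_mem_iff {W : Submodule ℝ (Fin (n + 1) → ℝ)} {w : Fin (n + 1) → ℝ} (hw : w ≠ 0) :
    (proj w).rep ∈ W ↔ w ∈ W := by
  obtain ⟨c, hc, h⟩ := exists_rep_proj hw
  rw [h, Submodule.smul_mem_iff _ hc]

theorem rep_act_mem_map_iff {L : (Fin (n + 1) → ℝ) →ₗ[ℝ] (Fin (n + 1) → ℝ)}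
    (hL : Function.Injective L) {W : Submodule ℝ (Fin (n + 1) → ℝ)} {x : RealProj n} :
    (act L x).rep ∈ W.map L ↔ x.rep ∈ W := by
  rw [act, rep_proj_mem_iff (apply_ne_zero hL x.rep_nonzero), Submodule.mem_map]
  exact ⟨fun ⟨w, hw, h⟩ => hL h ▸ hw, fun h => ⟨_, h, rfl⟩⟩

theorem _root_.exists_linearEquiv_apply_eq {E : Type*} [AddCommGroup E] [Module ℝ E]
    [FiniteDimensional ℝ E] (hE : Module.finrank ℝ E = p + 1) {v : E} (hv : v ≠ 0) :
    ∃ e : E ≃ₗ[ℝ] ℝ × EuclideanSpace ℝ (Fin p), e v = (1, 0) := by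
  obtain ⟨D, hD⟩ := Submodule.exists_isCompl (ℝ ∙ v)
  have h1 : Module.finrank ℝ D = p := by
    have := Submodule.finrank_add_eq_of_isCompl hD
    rw [finrank_span_singleton hv, hE] at this
    omega
  let e1 : D ≃ₗ[ℝ] EuclideanSpace ℝ (Fin p) := LinearEquiv.ofFinrankEq _ _ (by simp [h1])
  let e0 : (ℝ ∙ v) ≃ₗ[ℝ] ℝ := (LinearEquiv.toSpanNonzeroSingleton ℝ E v hv).symm
  refine ⟨(Submodule.prodEquivOfIsCompl _ _ hD).symm.trans (e0.prodCongr e1), ?_⟩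
  have h2 : (Submodule.prodEquivOfIsCompl _ _ hD).symm v =
      (⟨v, Submodule.mem_span_singleton_self v⟩, 0) := by
    rw [LinearEquiv.symm_apply_eq]
    simp
  have h3 : e0 ⟨v, Submodule.mem_span_singleton_self v⟩ = 1 := by
    rw [LinearEquiv.symm_apply_eq]
    simp
  rw [LinearEquiv.trans_apply, h2]
  simp [h3]

/-- Linear coordinates in which a vector is the first basis vector and a subspace containing it is a
coordinate subspace. -/
theorem exists_linearEquiv_mem_iff {W : Submodule ℝ (Fin (n + 1) → ℝ)} {v : Fin (n + 1) → ℝ}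
    (hv : v ≠ 0) (hvW : v ∈ W) (hW : Module.finrank ℝ W = p + 1) (hpq : p + q = n) :
    ∃ g : (Fin (n + 1) → ℝ) ≃ₗ[ℝ] ℝ × (EuclideanSpace ℝ (Fin p) × EuclideanSpace ℝ (Fin q)),
      g v = (1, 0, 0) ∧ ∀ w, w ∈ W ↔ (g w).2.2 = 0 := by
  obtain ⟨e, he⟩ := exists_linearEquiv_apply_eq hW (v := (⟨v, hvW⟩ : W))
    (fun h => hv (congrArg Subtype.val h))
  obtain ⟨D, hD⟩ := Submodule.exists_isCompl W
  have h1 : Module.finrank ℝ D = q := by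
    have := Submodule.finrank_add_eq_of_isCompl hD
    rw [hW, Module.finrank_fin_fun] at this
    omega
  let e1 : D ≃ₗ[ℝ] EuclideanSpace ℝ (Fin q) := LinearEquiv.ofFinrankEq _ _ (by simp [h1])
  let s := (Submodule.prodEquivOfIsCompl _ _ hD).symm
  refine ⟨(s.trans (e.prodCongr e1)).trans (LinearEquiv.prodAssoc ℝ _ _ _), ?_, fun w => ?_⟩
  · have h2 : s v = (⟨v, hvW⟩, 0) := by
      rw [LinearEquiv.symm_apply_eq]
      simp
    simp [h2, he]
  · have : w ∈ W ↔ (s w).2 = 0 :=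
      (Submodule.prodEquivOfIsCompl_symm_apply_snd_eq_zero W D hD).symm
    rw [this]
    simp

variable (n) in
/-- The splitting of `ℝ ^ (n + 1)` into the coordinate of index `0` and the other coordinates. -/
def headTail : (Fin (n + 1) → ℝ) ≃ₗ[ℝ] ℝ × EuclideanSpace ℝ (Fin n) where
  toFun v := (v 0, WithLp.toLp 2 fun j => v (Fin.succAbove 0 j))
  invFun t := Fin.cons t.1 t.2
  map_add' _ _ := rfl
  map_smul' _ _ := rfl
  left_inv v := by
    ext k
    refine Fin.cases ?_ (fun j => ?_) k <;> simp
  right_inv t := by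
    refine Prod.ext ?_ ?_
    · simp
    · ext j
      simp

theorem headTail_homog (y : EuclideanSpace ℝ (Fin n)) : headTail n (homog 0 y) = (1, y) := by
  refine Prod.ext ?_ ?_
  · exact homog_self 0 y
  · ext j
    exact homog_succAbove 0 y j

theorem affCoord_proj {v : Fin (n + 1) → ℝ} (hv : v ≠ 0) :
    affCoord 0 (proj v) = (headTail n v).1⁻¹ • (headTail n v).2 := by
  ext j
  rw [proj_of_ne_zero hv, affCoord_mk, PiLp.smul_apply, smul_eq_mul, div_eq_inv_mul]
  rfl

/-- The homeomorphism of projective space induced by a linear isomorphism. -/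
def actHomeomorph (g : (Fin (n + 1) → ℝ) ≃ₗ[ℝ] (Fin (n + 1) → ℝ)) : RealProj n ≃ₜ RealProj n where
  toFun := act g.toLinearMap
  invFun := act g.symm.toLinearMap
  left_inv x := by
    rw [← act_comp_of_injective _ g.injective]
    simp
  right_inv x := by
    rw [← act_comp_of_injective _ g.symm.injective]
    simp
  continuous_toFun := continuous_iff_continuousAt.2 fun x =>
    (contMDiffAt_act_const (I := 𝓡 n) contMDiffAt_id
      (apply_ne_zero g.injective x.rep_nonzero)).continuousAt
  continuous_invFun := continuous_iff_continuousAt.2 fun x =>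
    (contMDiffAt_act_const (I := 𝓡 n) contMDiffAt_id
      (apply_ne_zero g.symm.injective x.rep_nonzero)).continuousAt

theorem contMDiff_act (g : (Fin (n + 1) → ℝ) ≃ₗ[ℝ] (Fin (n + 1) → ℝ)) :
    ContMDiff (𝓡 n) (𝓡 n) ∞ (act g.toLinearMap) := fun x =>
  contMDiffAt_act_const (I := 𝓡 n) contMDiffAt_id (apply_ne_zero g.injective x.rep_nonzero)

/-- Around a point of a projective subspace there is an affine chart centered at the point in which
the projective subspace is a coordinate subspace. -/
theorem exists_adaptedChart (T : (EuclideanSpace ℝ (Fin p) × EuclideanSpace ℝ (Fin q)) ≃L[ℝ]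
    EuclideanSpace ℝ (Fin n)) {W : Submodule ℝ (Fin (n + 1) → ℝ)} {v : Fin (n + 1) → ℝ}
    (hv : v ≠ 0) (hvW : v ∈ W) (hW : Module.finrank ℝ W = p + 1) (hpq : p + q = n) :
    ∃ Ψ : OpenPartialHomeomorph (RealProj n) (EuclideanSpace ℝ (Fin n)),
      Ψ ∈ IsManifold.maximalAtlas (𝓡 n) ∞ (RealProj n) ∧ proj v ∈ Ψ.source ∧ Ψ (proj v) = 0 ∧
      (∀ z ∈ Ψ.source, (T.symm (Ψ z)).2 = 0 ↔ z.rep ∈ W) ∧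
      ∃ L : (Fin (p + 1) → ℝ) →ₗ[ℝ] (Fin (n + 1) → ℝ), Function.Injective L ∧
        LinearMap.range L = W ∧ L (homog 0 0) = v ∧
        ∀ z ∈ Ψ.source, z.rep ∈ W → z = proj (L (homog 0 (T.symm (Ψ z)).1)) := by
  obtain ⟨g, hgv, hgW⟩ := exists_linearEquiv_mem_iff hv hvW hW hpq
  let G : (Fin (n + 1) → ℝ) ≃ₗ[ℝ] (Fin (n + 1) → ℝ) :=
    g.trans (((LinearEquiv.refl ℝ ℝ).prodCongr T.toLinearEquiv).trans (headTail n).symm)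
  have hG : ∀ w, headTail n (G w) = ((g w).1, T (g w).2) := fun w => by simp [G]
  let Ψ := (actHomeomorph G).toOpenPartialHomeomorph.trans (affChart 0)
  have hsrc : ∀ {w : Fin (n + 1) → ℝ} (hw : w ≠ 0), proj w ∈ Ψ.source ↔ (g w).1 ≠ 0 := by
    intro w hw
    have h1 : proj w ∈ Ψ.source ↔ act G.toLinearMap (proj w) ∈ affDomain 0 := by
      rw [OpenPartialHomeomorph.trans_source]
      exact and_iff_right (mem_univ _)
    have h2 : G w 0 = (g w).1 := congrArg Prod.fst (hG w)
    have h3 : G w ≠ 0 := apply_ne_zero G.injective hw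
    rw [h1, act_proj _ hw, LinearEquiv.coe_coe, proj_of_ne_zero h3, mk_mem_affDomain, h2]
  have hval : ∀ {w : Fin (n + 1) → ℝ} (hw : w ≠ 0), Ψ (proj w) = (g w).1⁻¹ • T (g w).2 := by
    intro w hw
    have h1 : Ψ (proj w) = affCoord 0 (act G.toLinearMap (proj w)) := rfl
    have h2 : G w ≠ 0 := apply_ne_zero (L := G.toLinearMap) G.injective hw
    rw [h1, act_proj _ hw, LinearEquiv.coe_coe, affCoord_proj h2, hG]
  let L : (Fin (p + 1) → ℝ) →ₗ[ℝ] (Fin (n + 1) → ℝ) :=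
    g.symm.toLinearMap ∘ₗ (LinearMap.prodMap LinearMap.id (LinearMap.inl ℝ _ _)) ∘ₗ
      (headTail p).toLinearMap
  have hL : ∀ u, g (L u) = ((headTail p u).1, (headTail p u).2, 0) := fun u => by simp [L]
  refine ⟨Ψ, ?_, ?_, ?_, ?_, L, ?_, ?_, ?_, ?_⟩
  · refine OpenPartialHomeomorph.mem_maximalAtlas_of_contMDiffOn _ ?_ ?_
    · exact (contMDiffOn_of_mem_maximalAtlas (affChart_mem_maximalAtlas 0)).comp
        (contMDiff_act G).contMDiffOn fun z hz => hz.2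
    · exact (contMDiff_act G.symm).comp_contMDiffOn
        ((contMDiffOn_symm_of_mem_maximalAtlas (affChart_mem_maximalAtlas 0)).mono
          fun z hz => hz.1)
  · rw [hsrc hv, hgv]
    exact one_ne_zero
  · rw [hval hv, hgv]
    simp
  · intro z hz
    rw [← proj_rep z] at hz
    rw [hsrc z.rep_nonzero] at hz
    conv_lhs => rw [← proj_rep z]
    rw [hval z.rep_nonzero, map_smul, ContinuousLinearEquiv.symm_apply_apply, hgW, Prod.smul_snd,
      smul_eq_zero_iff_right (inv_ne_zero hz)]
  · intro u u' h
    have h1 := congrArg g h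
    rw [hL, hL] at h1
    simp only [Prod.mk.injEq] at h1
    exact (headTail p).injective (Prod.ext h1.1 h1.2.1)
  · ext w
    rw [hgW]
    constructor
    · rintro ⟨u, rfl⟩
      rw [hL]
    · intro h
      refine ⟨(headTail p).symm ((g w).1, (g w).2.1), g.injective ?_⟩
      rw [hL, LinearEquiv.apply_symm_apply]
      exact Prod.ext rfl (Prod.ext rfl h.symm)
  · refine g.injective ?_
    rw [hL, headTail_homog, hgv]
  · intro z hz hzW
    rw [← proj_rep z] at hz
    rw [hsrc z.rep_nonzero] at hz
    have h1 := (hgW _).1 hzW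
    have h2 : L (homog 0 (T.symm (Ψ z)).1) = (g z.rep).1⁻¹ • z.rep := by
      refine g.injective ?_
      rw [hL, headTail_homog, map_smul]
      conv_lhs => rw [← proj_rep z]
      rw [hval z.rep_nonzero, map_smul, ContinuousLinearEquiv.symm_apply_apply]
      refine Prod.ext ?_ (Prod.ext ?_ ?_)
      · simp [hz]
      · simp
      · simp [h1]
    rw [h2, proj_smul (inv_ne_zero hz), proj_rep]

end RealProj

/-! ### Finite covers by projective charts and the algebra of infinitesimal symmetries -/

section

variable {n : ℕ} {M : Type u} [TopologicalSpace M] [ChartedSpace (EuclideanSpace ℝ (Fin n)) M]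

open RealProj

theorem eventually_exists_inverse {A : Type*} [NormedRing A] [NormedAlgebra ℝ A]
    [FiniteDimensional ℝ A] :
    ∀ U ∈ 𝓝 (1 : A), ∀ᶠ a in 𝓝 (1 : A), ∃ b ∈ U, a * b = 1 ∧ b * a = 1 := by
  intro U hU
  have : CompleteSpace A := FiniteDimensional.complete ℝ A
  have h1 : Tendsto (Ring.inverse : A → A) (𝓝 1) (𝓝 1) := by
    have := (NormedRing.inverse_continuousAt (1 : Aˣ)).tendsto
    simpa using this
  filter_upwards [Units.nhds (1 : Aˣ), h1.eventually hU] with a ha hb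
  exact ⟨_, hb, Ring.mul_inverse_cancel a ha, Ring.inverse_mul_cancel a ha⟩

theorem exists_isPreconnected_of_eventually {E : Type*} [NormedAddCommGroup E] [NormedSpace ℝ E]
    {q : E → Prop} {a : E} (h : ∀ᶠ b in 𝓝 a, q b) :
    ∃ B : Set E, IsOpen B ∧ a ∈ B ∧ IsPreconnected B ∧ ∀ b ∈ B, q b := by
  obtain ⟨ε, hε, h⟩ := Metric.eventually_nhds_iff_ball.1 h
  exact ⟨_, Metric.isOpen_ball, Metric.mem_ball_self hε, (convex_ball a ε).isPreconnected, h⟩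

/-- A finite cover of a projective manifold by connected open sets, each with its closure contained
in the domain of a projective chart. -/
structure GoodCover (P : ProjectiveStructure n M) where
  /-- the index set -/
  ι : Type u
  [fintype : Fintype ι]
  /-- the projective charts -/
  chart : ι → OpenPartialHomeomorph M (RealProj n)
  chart_mem : ∀ i, chart i ∈ P.charts
  /-- the open sets of the cover -/
  piece : ι → Set M
  isOpen : ∀ i, IsOpen (piece i)
  isConnected : ∀ i, IsConnected (piece i)
  closure_subset : ∀ i, closure (piece i) ⊆ (chart i).source
  cover : ∀ x, ∃ i, x ∈ piece i

attribute [instance] GoodCover.fintype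

theorem GoodCover.exists_of_compact [T2Space M] [CompactSpace M] (P : ProjectiveStructure n M) :
    Nonempty (GoodCover P) := by
  have : LocallyConnectedSpace M :=
    ChartedSpace.locallyConnectedSpace (EuclideanSpace ℝ (Fin n)) M
  have h : ∀ x : M, ∃ (e : OpenPartialHomeomorph M (RealProj n)) (N : Set M), e ∈ P.charts ∧
      IsOpen N ∧ x ∈ N ∧ IsConnected N ∧ closure N ⊆ e.source := by
    intro x
    obtain ⟨e, he, hx⟩ := P.cover x
    obtain ⟨K, hK, hKc, hKe⟩ := exists_mem_nhds_isClosed_subset (e.open_source.mem_nhds hx)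
    obtain ⟨N, hNK, hN, hxN, hNc⟩ :=
      locallyConnectedSpace_iff_subsets_isOpen_isConnected.1 this x K hK
    exact ⟨e, N, he, hN, hxN, hNc, (closure_minimal hNK hKc).trans hKe⟩
  choose e N he hN hxN hNc hNe using h
  obtain ⟨t, -, ht⟩ := isCompact_univ.elim_nhds_subcover N fun x _ => (hN x).mem_nhds (hxN x)
  refine ⟨⟨t, fun i => e i, fun i => he i, fun i => N i, fun i => hN i, fun i => hNc i,
    fun i => hNe i, fun x => ?_⟩⟩
  obtain ⟨y, hy, hxy⟩ := mem_iUnion₂.1 (ht (mem_univ x))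
  exact ⟨⟨y, hy⟩, hxy⟩

theorem ProjectiveStructure.exists_act_eq (P : ProjectiveStructure n M)
    {e e' : OpenPartialHomeomorph M (RealProj n)} (he : e ∈ P.charts) (he' : e' ∈ P.charts) {x : M}
    (hx : x ∈ e.source) (hx' : x ∈ e'.source) :
    ∃ g : (Fin (n + 1) → ℝ) ≃ₗ[ℝ] (Fin (n + 1) → ℝ),
      ∀ᶠ y in 𝓝 x, e' y = act g.toLinearMap (e y) := by
  obtain ⟨g, hg⟩ := P.compat e he e' he' x ⟨hx, hx'⟩
  refine ⟨g, hg.mono fun y hy => ?_⟩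
  rw [hy, map_eq_act]

/-- A smooth map that acts linearly in one pair of projective charts around each point is a
projective map. -/
theorem IsProjectiveMap.of_exists {p : ℕ} {F : Type*} [TopologicalSpace F]
    [ChartedSpace (EuclideanSpace ℝ (Fin p)) F] {Q : ProjectiveStructure p F}
    {P : ProjectiveStructure n M} {f : F → M} (hf : ContMDiff (𝓡 p) (𝓡 n) ∞ f)
    (h : ∀ x, ∃ e ∈ Q.charts, x ∈ e.source ∧ ∃ e' ∈ P.charts, f x ∈ e'.source ∧
      ∃ L : (Fin (p + 1) → ℝ) →ₗ[ℝ] (Fin (n + 1) → ℝ), Function.Injective L ∧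
        ∀ᶠ y in 𝓝 x, e' (f y) = act L (e y)) : IsProjectiveMap Q P f where
  contMDiff := hf
  eventually_eq x d hd hxd d' hd' hxd' := by
    obtain ⟨e, he, hxe, e', he', hxe', L, hL, hLe⟩ := h x
    obtain ⟨g, hg⟩ := Q.exists_act_eq hd he hxd hxe
    obtain ⟨k, hk⟩ := P.exists_act_eq he' hd' hxe' hxd'
    refine ⟨k.toLinearMap ∘ₗ L ∘ₗ g.toLinearMap, k.injective.comp (hL.comp g.injective), ?_⟩
    filter_upwards [hLe, hg, hf.continuous.continuousAt.eventually hk] with y h1 h2 h3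
    rw [map_eq_act, h3, h1, h2,
      act_comp_of_injective _ (L := L ∘ₗ g.toLinearMap) (hL.comp g.injective),
      act_comp_of_injective _ g.injective]

namespace GoodCover

variable {P : ProjectiveStructure n M} (C : GoodCover P)

theorem piece_subset (i : C.ι) : C.piece i ⊆ (C.chart i).source :=
  subset_closure.trans (C.closure_subset i)

theorem exists_act_eq {i j : C.ι} {x : M} (hi : x ∈ (C.chart i).source)
    (hj : x ∈ (C.chart j).source) : ∃ g : (Fin (n + 1) → ℝ) ≃ₗ[ℝ] (Fin (n + 1) → ℝ),
      ∀ᶠ y in 𝓝 x, C.chart j y = act g.toLinearMap (C.chart i y) :=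
  P.exists_act_eq (C.chart_mem i) (C.chart_mem j) hi hj

/-- The algebra of the families of endomorphisms of `ℝ ^ (n + 1)`, one for each piece of the cover,
which are intertwined by the changes of charts. These are the global sections of a flat bundle of
associative algebras over `M`, and its elements modulo the locally constant scalars are
the projective vector fields of `M`. -/
def symAlg : Subalgebra ℝ (C.ι → (Fin (n + 1) → ℝ) →L[ℝ] (Fin (n + 1) → ℝ)) where
  carrier := {a | ∀ i j, ∀ x, x ∈ C.piece i → x ∈ C.piece j →
    ∀ g : (Fin (n + 1) → ℝ) ≃ₗ[ℝ] (Fin (n + 1) → ℝ),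
      (∀ᶠ y in 𝓝 x, C.chart j y = act g.toLinearMap (C.chart i y)) → ∀ v, a j (g v) = g (a i v)}
  mul_mem' := by
    intro a b ha hb i j x hi hj g hg v
    change a j (b j (g v)) = g (a i (b i v))
    rw [hb i j x hi hj g hg, ha i j x hi hj g hg]
  add_mem' := by
    intro a b ha hb i j x hi hj g hg v
    simp only [Pi.add_apply, add_apply]
    rw [hb i j x hi hj g hg, ha i j x hi hj g hg, map_add]
  algebraMap_mem' := by
    intro r i j x hi hj g hg v
    simp [Algebra.algebraMap_eq_smul_one]

theorem symAlg_apply (a : C.symAlg) {i j : C.ι} {x : M} (hi : x ∈ C.piece i) (hj : x ∈ C.piece j)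
    {g : (Fin (n + 1) → ℝ) ≃ₗ[ℝ] (Fin (n + 1) → ℝ)}
    (hg : ∀ᶠ y in 𝓝 x, C.chart j y = act g.toLinearMap (C.chart i y)) (v : Fin (n + 1) → ℝ) :
    a.1 j (g v) = g (a.1 i v) := a.2 i j x hi hj g hg v

theorem continuous_eval (i : C.ι) : Continuous fun a : C.symAlg => a.1 i :=
  (continuous_apply i).comp continuous_subtype_val

/-- The local diffeomorphism of `M` given by a linear map in the `i`-th chart. It is a total
function, with junk values where the point or its image is not covered by the chart. -/
def localMap (i : C.ι) (L : (Fin (n + 1) → ℝ) →L[ℝ] (Fin (n + 1) → ℝ)) (x : M) : M :=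
  (C.chart i).symm (act (L : (Fin (n + 1) → ℝ) →ₗ[ℝ] (Fin (n + 1) → ℝ)) (C.chart i x))

/-- The condition that the formula for `localMap` has its geometric meaning: no junk value of `act`
or of the inverse chart occurs. -/
structure Regular (i : C.ι) (L : (Fin (n + 1) → ℝ) →L[ℝ] (Fin (n + 1) → ℝ)) (x : M) : Prop where
  mem_source : x ∈ (C.chart i).source
  injective : Function.Injective L
  mem_target : act (L : (Fin (n + 1) → ℝ) →ₗ[ℝ] (Fin (n + 1) → ℝ)) (C.chart i x) ∈
    (C.chart i).target

variable {C}

theorem Regular.localMap_mem {i : C.ι} {L : (Fin (n + 1) → ℝ) →L[ℝ] (Fin (n + 1) → ℝ)} {x : M}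
    (h : C.Regular i L x) : C.localMap i L x ∈ (C.chart i).source :=
  (C.chart i).map_target h.mem_target

theorem Regular.chart_localMap {i : C.ι} {L : (Fin (n + 1) → ℝ) →L[ℝ] (Fin (n + 1) → ℝ)} {x : M}
    (h : C.Regular i L x) : C.chart i (C.localMap i L x) =
      act (L : (Fin (n + 1) → ℝ) →ₗ[ℝ] (Fin (n + 1) → ℝ)) (C.chart i x) :=
  (C.chart i).right_inv h.mem_target

theorem Regular.localMap_mul {i : C.ι} {K L : (Fin (n + 1) → ℝ) →L[ℝ] (Fin (n + 1) → ℝ)} {x : M}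
    (h : C.Regular i L x) : C.localMap i (K * L) x = C.localMap i K (C.localMap i L x) := by
  rw [localMap.eq_1 C i K, h.chart_localMap, ← act_comp_of_injective _ h.injective]
  rfl

theorem localMap_one {i : C.ι} {x : M} (h : x ∈ (C.chart i).source) : C.localMap i 1 x = x := by
  rw [localMap, ContinuousLinearMap.toLinearMap_one, act_one]
  exact (C.chart i).left_inv h

theorem regular_one {i : C.ι} {x : M} (h : x ∈ (C.chart i).source) : C.Regular i 1 x :=
  ⟨h, Function.injective_id, by
    rw [ContinuousLinearMap.toLinearMap_one, act_one]
    exact (C.chart i).map_source h⟩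

theorem Regular.apply_ne_zero {i : C.ι} {L : (Fin (n + 1) → ℝ) →L[ℝ] (Fin (n + 1) → ℝ)} {x : M}
    (h : C.Regular i L x) {v : Fin (n + 1) → ℝ} (hv : v ≠ 0) : L v ≠ 0 := by
  rw [← map_zero L]
  exact h.injective.ne hv

section

variable {E H N : Type*} [NormedAddCommGroup E] [NormedSpace ℝ E] [TopologicalSpace H]
  {I : ModelWithCorners ℝ E H} [TopologicalSpace N] [ChartedSpace H N]

theorem Regular.contMDiffAt_act {i : C.ι}
    {u : N → (Fin (n + 1) → ℝ) →L[ℝ] (Fin (n + 1) → ℝ)} {h : N → M}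
    {x : N} (hx : C.Regular i (u x) (h x))
    (hu : ContMDiffAt I 𝓘(ℝ, (Fin (n + 1) → ℝ) →L[ℝ] (Fin (n + 1) → ℝ)) ∞ u x)
    (hh : ContMDiffAt I (𝓡 n) ∞ h x) :
    ContMDiffAt I (𝓡 n) ∞ (fun y => act (u y : (Fin (n + 1) → ℝ) →ₗ[ℝ] (Fin (n + 1) → ℝ))
      (C.chart i (h y))) x :=
  RealProj.contMDiffAt_act hu
    (((P.contMDiffOn _ (C.chart_mem i)).contMDiffAt
      ((C.chart i).open_source.mem_nhds hx.mem_source)).comp x hh)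
    (hx.apply_ne_zero (Projectivization.rep_nonzero _))

theorem Regular.contMDiffAt_localMap {i : C.ι}
    {u : N → (Fin (n + 1) → ℝ) →L[ℝ] (Fin (n + 1) → ℝ)} {h : N → M}
    {x : N} (hx : C.Regular i (u x) (h x))
    (hu : ContMDiffAt I 𝓘(ℝ, (Fin (n + 1) → ℝ) →L[ℝ] (Fin (n + 1) → ℝ)) ∞ u x)
    (hh : ContMDiffAt I (𝓡 n) ∞ h x) :
    ContMDiffAt I (𝓡 n) ∞ (fun y => C.localMap i (u y) (h y)) x :=
  ((P.contMDiffOn_symm _ (C.chart_mem i)).contMDiffAt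
    ((C.chart i).open_target.mem_nhds hx.mem_target)).comp x (hx.contMDiffAt_act hu hh)

end

theorem Regular.continuousAt {i : C.ι} {L : (Fin (n + 1) → ℝ) →L[ℝ] (Fin (n + 1) → ℝ)} {x : M}
    (h : C.Regular i L x) :
    ContinuousAt (fun q : ((Fin (n + 1) → ℝ) →L[ℝ] (Fin (n + 1) → ℝ)) × M =>
      C.localMap i q.1 q.2) (L, x) :=
  (Regular.contMDiffAt_localMap
    (I := 𝓘(ℝ, (Fin (n + 1) → ℝ) →L[ℝ] (Fin (n + 1) → ℝ)).prod (𝓡 n))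
    (u := Prod.fst) (h := Prod.snd) (x := (L, x)) h contMDiffAt_fst contMDiffAt_snd).continuousAt

theorem eventually_injective :
    ∀ᶠ L : (Fin (n + 1) → ℝ) →L[ℝ] (Fin (n + 1) → ℝ) in 𝓝 1, Function.Injective L := by
  filter_upwards [Units.nhds (1 : ((Fin (n + 1) → ℝ) →L[ℝ] (Fin (n + 1) → ℝ))ˣ)]
  rintro _ ⟨L, rfl⟩
  exact Function.LeftInverse.injective (g := (L⁻¹).1) fun v => by
    rw [← mul_apply_eq_comp, Units.inv_mul, one_apply_eq_self]

theorem eventually_regular {i : C.ι} {x : M} (h : x ∈ (C.chart i).source) :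
    ∀ᶠ q : ((Fin (n + 1) → ℝ) →L[ℝ] (Fin (n + 1) → ℝ)) × M in 𝓝 (1, x),
      C.Regular i q.1 q.2 := by
  have h1 : ContinuousAt (fun q : ((Fin (n + 1) → ℝ) →L[ℝ] (Fin (n + 1) → ℝ)) × M =>
      act (q.1 : (Fin (n + 1) → ℝ) →ₗ[ℝ] (Fin (n + 1) → ℝ)) (C.chart i q.2)) (1, x) :=
    (Regular.contMDiffAt_act
      (I := 𝓘(ℝ, (Fin (n + 1) → ℝ) →L[ℝ] (Fin (n + 1) → ℝ)).prod (𝓡 n))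
      (u := Prod.fst) (h := Prod.snd) (x := (1, x)) (regular_one h) contMDiffAt_fst
      contMDiffAt_snd).continuousAt
  filter_upwards [continuousAt_fst.eventually eventually_injective,
    continuousAt_snd.eventually ((C.chart i).open_source.mem_nhds h),
    h1.eventually ((C.chart i).open_target.mem_nhds (regular_one h).mem_target)] with q h2 h3 h4
  exact ⟨h3, h2, h4⟩

theorem tendsto_eval_prod (i : C.ι) (a : C.symAlg) (x : M) :
    Tendsto (fun q : C.symAlg × M => (q.1.1 i, q.2)) (𝓝 (a, x)) (𝓝 (a.1 i, x)) :=
  (((C.continuous_eval i).comp continuous_fst).prodMk continuous_snd).tendsto (a, x)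

/-- Near a point of the closures of two pieces, the two local maps of a section of the algebra
close to `1` agree. -/
theorem eventually_localMap_eq (i j : C.ι) (x : M) :
    ∀ᶠ q : C.symAlg × M in 𝓝 (1, x), q.2 ∈ C.piece i → q.2 ∈ C.piece j →
      C.localMap i (q.1.1 i) q.2 = C.localMap j (q.1.1 j) q.2 := by
  by_cases hi : x ∈ closure (C.piece i)
  swap
  · filter_upwards [continuousAt_snd.eventually (isClosed_closure.isOpen_compl.mem_nhds hi)]
      with q hq h1
    exact absurd (subset_closure h1) hq
  by_cases hj : x ∈ closure (C.piece j)
  swap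
  · filter_upwards [continuousAt_snd.eventually (isClosed_closure.isOpen_compl.mem_nhds hj)]
      with q hq _ h1
    exact absurd (subset_closure h1) hq
  replace hi := C.closure_subset i hi
  replace hj := C.closure_subset j hj
  obtain ⟨g, hg⟩ := C.exists_act_eq hi hj
  have h1 : Tendsto (fun q : C.symAlg × M => C.localMap i (q.1.1 i) q.2) (𝓝 (1, x)) (𝓝 x) := by
    have := (regular_one hi).continuousAt.tendsto.comp (tendsto_eval_prod i 1 x)
    simp only [localMap_one hi] at this
    exact this
  filter_upwards [h1.eventually hg, h1.eventually ((C.chart j).open_source.mem_nhds hj),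
    continuousAt_snd.eventually (eventually_eventually_nhds.2 hg),
    (tendsto_eval_prod i 1 x).eventually (eventually_regular hi),
    (tendsto_eval_prod j 1 x).eventually (eventually_regular hj)] with q h2 h3 h4 h5 h6 h7 h8
  refine (C.chart j).injOn h3 h6.localMap_mem ?_
  rw [h6.chart_localMap, h2, h5.chart_localMap, h4.self_of_nhds,
    ← act_comp_of_injective _ h5.injective, ← act_comp_of_injective _ g.injective]
  congr 1
  exact LinearMap.ext fun v => (C.symAlg_apply q.1 h7 h8 h4 v).symm

variable (C) in
/-- The map of `M` defined by a section of the algebra close to `1`: it acts linearly in each chart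
of the cover. -/
def toMap (a : C.symAlg) (x : M) : M :=
  C.localMap (C.cover x).choose (a.1 (C.cover x).choose) x

variable (C) in
/-- The condition that the local maps of a section of the algebra are well defined and fit
together. -/
def Integrable (a : C.symAlg) : Prop :=
  ∀ x i, x ∈ C.piece i → C.Regular i (a.1 i) x ∧ C.toMap a x = C.localMap i (a.1 i) x

variable (C) in
/-- By compactness of `M`, a section sufficiently close to `1` acts on all of `M`. -/
theorem eventually_integrable [CompactSpace M] : ∀ᶠ a in 𝓝 (1 : C.symAlg), C.Integrable a := by
  have h := isCompact_univ.eventually_forall_of_forall_eventually (x₀ := (1 : C.symAlg))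
    (K := univ) (P := fun a x => ∀ i, x ∈ C.piece i → C.Regular i (a.1 i) x ∧
      ∀ j, x ∈ C.piece j → C.localMap i (a.1 i) x = C.localMap j (a.1 j) x) (by
    intro x _
    refine eventually_all.2 fun i => ?_
    by_cases hi : x ∈ closure (C.piece i)
    swap
    · filter_upwards [continuousAt_snd.eventually (isClosed_closure.isOpen_compl.mem_nhds hi)]
        with q hq h1
      exact absurd (subset_closure h1) hq
    filter_upwards [eventually_all.2 fun j => eventually_localMap_eq i j x,
      (tendsto_eval_prod i 1 x).eventually (eventually_regular (C.closure_subset i hi))]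
      with q h1 h2 h3
    exact ⟨h2, fun j hj => h1 j h3 hj⟩)
  filter_upwards [h] with a ha x i hi
  exact ⟨(ha x (mem_univ x) i hi).1,
    (ha x (mem_univ x) _ (C.cover x).choose_spec).2 i hi⟩

theorem toMap_one (x : M) : C.toMap 1 x = x :=
  localMap_one (C.piece_subset _ (C.cover x).choose_spec)

theorem Integrable.chart_toMap {a : C.symAlg} (ha : C.Integrable a) {i : C.ι} {x : M}
    (hx : x ∈ C.piece i) : C.chart i (C.toMap a x) =
      act (a.1 i : (Fin (n + 1) → ℝ) →ₗ[ℝ] (Fin (n + 1) → ℝ)) (C.chart i x) := by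
  rw [(ha x i hx).2, (ha x i hx).1.chart_localMap]

theorem Integrable.toMap_mem {a : C.symAlg} (ha : C.Integrable a) {i : C.ι} {x : M}
    (hx : x ∈ C.piece i) : C.toMap a x ∈ (C.chart i).source := by
  rw [(ha x i hx).2]
  exact (ha x i hx).1.localMap_mem

theorem Integrable.isProjectiveMap {a : C.symAlg} (ha : C.Integrable a) :
    IsProjectiveMap P P (C.toMap a) := by
  refine IsProjectiveMap.of_exists (fun x => ?_) fun x => ?_
  · obtain ⟨i, hi⟩ := C.cover x
    refine ((ha x i hi).1.contMDiffAt_localMap (I := 𝓡 n) (u := fun _ => a.1 i) (h := fun y => y)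
      contMDiffAt_const contMDiffAt_id).congr_of_eventuallyEq ?_
    filter_upwards [(C.isOpen i).mem_nhds hi] with y hy
    exact (ha y i hy).2
  · obtain ⟨i, hi⟩ := C.cover x
    refine ⟨_, C.chart_mem i, C.piece_subset i hi, _, C.chart_mem i, ha.toMap_mem hi, _,
      (ha x i hi).1.injective, ?_⟩
    filter_upwards [(C.isOpen i).mem_nhds hi] with y hy
    exact ha.chart_toMap hy

theorem continuousAt_toMap {a : C.symAlg} (ha : ∀ᶠ b in 𝓝 a, C.Integrable b) (x : M) :
    ContinuousAt (fun q : C.symAlg × M => C.toMap q.1 q.2) (a, x) := by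
  obtain ⟨i, hi⟩ := C.cover x
  have h1 : ContinuousAt (fun q : C.symAlg × M => C.localMap i (q.1.1 i) q.2) (a, x) :=
    ContinuousAt.comp (f := fun q : C.symAlg × M => (q.1.1 i, q.2)) (x := (a, x))
      (ha.self_of_nhds x i hi).1.continuousAt (tendsto_eval_prod i a x)
  refine h1.congr ?_
  filter_upwards [continuousAt_fst.eventually ha,
    continuousAt_snd.eventually ((C.isOpen i).mem_nhds hi)] with q h2 h3
  exact (h2 q.2 i h3).2.symm

theorem tendsto_toMap_one [CompactSpace M] (x : M) :
    Tendsto (fun q : C.symAlg × M => C.toMap q.1 q.2) (𝓝 (1, x)) (𝓝 x) := by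
  have := (continuousAt_toMap (C.eventually_integrable) x).tendsto
  rwa [toMap_one] at this

variable (C) in
theorem eventually_toMap_mul [CompactSpace M] :
    ∀ᶠ q : C.symAlg × C.symAlg in 𝓝 (1, 1),
      ∀ x, C.toMap (q.1 * q.2) x = C.toMap q.1 (C.toMap q.2 x) := by
  have h := isCompact_univ.eventually_forall_of_forall_eventually
    (x₀ := ((1, 1) : C.symAlg × C.symAlg))
    (K := univ) (P := fun q x => C.toMap (q.1 * q.2) x = C.toMap q.1 (C.toMap q.2 x)) (by
    intro x _
    obtain ⟨i, hi⟩ := C.cover x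
    have h1 : Tendsto (fun z : (C.symAlg × C.symAlg) × M => z.1.1 * z.1.2) (𝓝 ((1, 1), x))
        (𝓝 1) := by
      have : Continuous (fun z : (C.symAlg × C.symAlg) × M => z.1.1 * z.1.2) :=
        (continuous_fst.comp continuous_fst).mul (continuous_snd.comp continuous_fst)
      have h := this.tendsto ((1, 1), x)
      rwa [mul_one] at h
    have h2 : Tendsto (fun z : (C.symAlg × C.symAlg) × M => z.1.1) (𝓝 ((1, 1), x)) (𝓝 1) :=
      (continuous_fst.comp continuous_fst).tendsto ((1, 1), x)
    have h3 : Tendsto (fun z : (C.symAlg × C.symAlg) × M => (z.1.2, z.2)) (𝓝 ((1, 1), x))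
        (𝓝 (1, x)) :=
      ((continuous_snd.comp continuous_fst).prodMk continuous_snd).tendsto ((1, 1), x)
    have h4 := (tendsto_toMap_one x).comp h3
    filter_upwards [h1.eventually C.eventually_integrable, h2.eventually C.eventually_integrable,
      (continuous_fst.tendsto _ |>.comp h3).eventually C.eventually_integrable,
      (continuous_snd.tendsto _ |>.comp h3).eventually ((C.isOpen i).mem_nhds hi),
      h4.eventually ((C.isOpen i).mem_nhds hi)] with z k1 k2 k3 k4 k5
    simp only [Function.comp_apply] at k3 k4 k5
    rw [(k1 _ i k4).2, (k2 _ i k5).2, (k3 _ i k4).2]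
    exact (k3 _ i k4).1.localMap_mul)
  filter_upwards [h] with q hq x
  exact hq x (mem_univ x)

instance : FiniteDimensional ℝ C.symAlg :=
  FiniteDimensional.finiteDimensional_submodule C.symAlg.toSubmodule

variable (C) in
/-- The map defined by a section close to `1` is bijective since the section is invertible in the
algebra, with an inverse close to `1`. -/
theorem eventually_exists_aut [CompactSpace M] :
    ∀ᶠ a in 𝓝 (1 : C.symAlg), ∃ f : P.aut, ∀ x, f.1 x = C.toMap a x := by
  obtain ⟨U, hU, V, hV, h⟩ := mem_nhds_prod_iff.1 C.eventually_toMap_mul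
  filter_upwards [eventually_exists_inverse (A := C.symAlg) _ (inter_mem (inter_mem hU hV)
    C.eventually_integrable), inter_mem (inter_mem hU hV) C.eventually_integrable]
  rintro a ⟨b, ⟨⟨hbU, hbV⟩, hb⟩, hab, hba⟩ ⟨⟨haU, haV⟩, ha⟩
  have h1 : ∀ x, C.toMap a (C.toMap b x) = x := fun x => by
    rw [← h (mk_mem_prod haU hbV) x]
    simp only [hab, toMap_one]
  have h2 : ∀ x, C.toMap b (C.toMap a x) = x := fun x => by
    rw [← h (mk_mem_prod hbU haV) x]
    simp only [hba, toMap_one]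
  exact ⟨⟨⟨⟨C.toMap a, C.toMap b, h2, h1⟩, ha.isProjectiveMap.contMDiff.continuous,
    hb.isProjectiveMap.contMDiff.continuous⟩, ha.isProjectiveMap, hb.isProjectiveMap⟩,
    fun x => rfl⟩

variable (C) in
/-- The sections of the algebra close to `1` define automorphisms in the identity component. -/
theorem eventually_exists_autZero [CompactSpace M] :
    ∀ᶠ a in 𝓝 (1 : C.symAlg), ∃ f ∈ P.autZero, ∀ x, f.1 x = C.toMap a x := by
  obtain ⟨B, hB, h1B, hBc, h⟩ := exists_isPreconnected_of_eventually (E := C.symAlg)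
    (C.eventually_exists_aut.and C.eventually_integrable)
  choose f hf using fun a : B => (h a.1 a.2).1
  -- the sections in a small ball form a connected set of automorphisms containing the identity
  have hc : Continuous f := by
    refine continuous_induced_rng.2 ?_
    refine ContinuousMap.continuous_of_continuous_uncurry _ ?_
    have : ContinuousOn (fun q : C.symAlg × M => C.toMap q.1 q.2)
        (B ×ˢ univ) := by
      rintro ⟨a, x⟩ ⟨ha, -⟩
      refine (continuousAt_toMap ?_ x).continuousWithinAt
      filter_upwards [hB.mem_nhds ha] with b hb
      exact (h b hb).2
    have h2 := this.comp_continuous (f := fun q : B × M => (q.1.1, q.2))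
      (by fun_prop) (fun q => ⟨q.1.2, mem_univ _⟩)
    refine h2.congr fun q => ?_
    exact (hf q.1 q.2).symm
  have : PreconnectedSpace B := Subtype.preconnectedSpace hBc
  have h1 : f ⟨1, h1B⟩ = 1 := by
    ext x
    rw [hf, toMap_one]
    rfl
  filter_upwards [hB.mem_nhds h1B] with a ha
  refine ⟨f ⟨a, ha⟩, ?_, hf _⟩
  exact (isPreconnected_range hc).subset_connectedComponent ⟨_, h1⟩ (mem_range_self _)

end GoodCover

/-! ### Automorphisms close to the identity -/

theorem continuous_aut_eval [T2Space M] [CompactSpace M] (P : ProjectiveStructure n M) :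
    Continuous fun q : P.aut × M => q.1.1 q.2 := by
  have h0 : Continuous P.autToContinuousMap := continuous_induced_dom
  have h : Continuous fun q : P.aut × M => P.autToContinuousMap q.1 q.2 :=
    Continuous.eval (h0.comp continuous_fst) continuous_snd
  exact h

theorem tendsto_aut_eval_one [T2Space M] [CompactSpace M] (P : ProjectiveStructure n M) (x : M) :
    Tendsto (fun q : P.aut × M => q.1.1 q.2) (𝓝 (1, x)) (𝓝 x) :=
  (continuous_aut_eval P).tendsto (1, x)

variable (n) in
/-- The trace of a continuous endomorphism of `ℝ ^ (n + 1)`. -/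
def clmTrace : ((Fin (n + 1) → ℝ) →L[ℝ] (Fin (n + 1) → ℝ)) →ₗ[ℝ] ℝ :=
  LinearMap.trace ℝ (Fin (n + 1) → ℝ) ∘ₗ ContinuousLinearMap.coeLM ℝ

theorem clmTrace_one : clmTrace n 1 = n + 1 := by
  change LinearMap.trace ℝ (Fin (n + 1) → ℝ) 1 = n + 1
  simp

theorem continuous_clmTrace : Continuous (clmTrace n) :=
  LinearMap.continuous_of_finiteDimensional _

/-- The multiple of an endomorphism whose trace is that of the identity. -/
def traceNormalize (L : (Fin (n + 1) → ℝ) →L[ℝ] (Fin (n + 1) → ℝ)) :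
    (Fin (n + 1) → ℝ) →L[ℝ] (Fin (n + 1) → ℝ) := ((n + 1) / clmTrace n L) • L

theorem traceNormalize_smul_one {c : ℝ} (hc : c ≠ 0) :
    traceNormalize (c • (1 : (Fin (n + 1) → ℝ) →L[ℝ] (Fin (n + 1) → ℝ))) = 1 := by
  have h : (n : ℝ) + 1 ≠ 0 := by positivity
  rw [traceNormalize, map_smul, clmTrace_one, smul_smul, smul_eq_mul]
  have : ((n : ℝ) + 1) / (c * (n + 1)) * c = 1 := by field_simp
  rw [this, one_smul]

theorem clmTrace_traceNormalize {L : (Fin (n + 1) → ℝ) →L[ℝ] (Fin (n + 1) → ℝ)}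
    (h : clmTrace n L ≠ 0) : clmTrace n (traceNormalize L) = n + 1 := by
  rw [traceNormalize, map_smul, smul_eq_mul, div_mul_cancel₀ _ h]

theorem continuousAt_traceNormalize {L : (Fin (n + 1) → ℝ) →L[ℝ] (Fin (n + 1) → ℝ)}
    (h : clmTrace n L ≠ 0) : ContinuousAt traceNormalize L :=
  (continuousAt_const.div continuous_clmTrace.continuousAt h).smul continuousAt_id

namespace GoodCover

variable {P : ProjectiveStructure n M} (C : GoodCover P)

/-- The automorphism `f` acts on the `i`-th piece of the cover, in the `i`-th chart, by the
injective endomorphism `L`. -/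
structure Represents (i : C.ι) (f : P.aut) (L : (Fin (n + 1) → ℝ) →L[ℝ] (Fin (n + 1) → ℝ)) :
    Prop where
  injective : Function.Injective L
  mem_source : ∀ x ∈ C.piece i, f.1 x ∈ (C.chart i).source
  chart_eq : ∀ x ∈ C.piece i, C.chart i (f.1 x) =
    act (L : (Fin (n + 1) → ℝ) →ₗ[ℝ] (Fin (n + 1) → ℝ)) (C.chart i x)

variable {C}

theorem Represents.smul {i : C.ι} {f : P.aut} {L : (Fin (n + 1) → ℝ) →L[ℝ] (Fin (n + 1) → ℝ)}
    (h : C.Represents i f L) {c : ℝ} (hc : c ≠ 0) : C.Represents i f (c • L) where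
  injective := (smul_right_injective _ hc).comp h.injective
  mem_source := h.mem_source
  chart_eq x hx := by
    rw [h.chart_eq x hx, ContinuousLinearMap.toLinearMap_smul, act_smul hc]

theorem Represents.ne_zero {i : C.ι} {f : P.aut} {L : (Fin (n + 1) → ℝ) →L[ℝ] (Fin (n + 1) → ℝ)}
    (h : C.Represents i f L) : L ≠ 0 := by
  rintro rfl
  have := h.injective (a₁ := 1) (a₂ := 0) rfl
  exact one_ne_zero this

/-- Representing endomorphisms of an automorphism near two points of a connected piece are
proportional, so that one of them represents the automorphism on the whole piece. -/
theorem exists_represents {i : C.ι} {f : P.aut}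
    (hf : ∀ x ∈ C.piece i, f.1 x ∈ (C.chart i).source) : ∃ L, C.Represents i f L := by
  have h : ∀ x ∈ C.piece i, ∃ L : (Fin (n + 1) → ℝ) →ₗ[ℝ] (Fin (n + 1) → ℝ),
      Function.Injective L ∧ ∀ᶠ y in 𝓝 x, C.chart i (f.1 y) = act L (C.chart i y) := by
    intro x hx
    obtain ⟨L, hL, h⟩ := f.2.1.eventually_eq x _ (C.chart_mem i) (C.piece_subset i hx) _
      (C.chart_mem i) (hf x hx)
    exact ⟨L, hL, h.mono fun y hy => by rw [hy, map_eq_act]⟩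
  obtain ⟨x₀, hx₀⟩ := (C.isConnected i).nonempty
  obtain ⟨L, hL, hLe⟩ := h x₀ hx₀
  have hsub : C.piece i ⊆ {x | ∀ᶠ y in 𝓝 x, C.chart i (f.1 y) = act L (C.chart i y)} := by
    refine (C.isConnected i).isPreconnected.subset_of_closure_inter_subset
      isOpen_setOfPred_eventually_nhds ⟨x₀, hx₀, hLe⟩ ?_
    rintro x ⟨hxc, hx⟩
    obtain ⟨K, hK, hKe⟩ := h x hx
    obtain ⟨y, ⟨hyK, hyi⟩, hyL⟩ := mem_closure_iff_nhds.1 hxc _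
      ((eventually_eventually_nhds.2 hKe).and ((C.isOpen i).mem_nhds hx))
    obtain ⟨c, hc, rfl⟩ := exists_eq_smul_of_chart_eventuallyEq (C.piece_subset i hyi) hL hK
      ((hyL.and hyK).mono fun z hz => hz.1.symm.trans hz.2)
    exact hKe.mono fun z hz => by rw [hz, act_smul hc]
  exact ⟨L.toContinuousLinearMap, hL, hf, fun x hx => (hsub hx).self_of_nhds⟩

section

variable [T2Space M] [CompactSpace M]

/-- For an automorphism `f` converging to the identity, the normalized endomorphisms that represent
it converge to the identity. The unit sphere being compact, it suffices that a limit of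
representing endomorphisms of norm `1` is scalar, and it is since it fixes an open set of lines. -/
theorem eventually_traceNormalize_mem (i : C.ι)
    {W : Set ((Fin (n + 1) → ℝ) →L[ℝ] (Fin (n + 1) → ℝ))}
    (hW : W ∈ 𝓝 1) : ∀ᶠ f in 𝓝 (1 : P.aut),
      ∀ L ∈ Metric.sphere (0 : (Fin (n + 1) → ℝ) →L[ℝ] (Fin (n + 1) → ℝ)) 1,
        C.Represents i f L → clmTrace n L ≠ 0 ∧ traceNormalize L ∈ W := by
  refine (isCompact_sphere _ _).eventually_forall_of_forall_eventually fun L hL => ?_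
  by_cases hc : ∃ x ∈ C.piece i, ∃ m, C.chart i x ∈ affDomain m ∧ ∃ k l,
      L (lift m (C.chart i x)) k * lift m (C.chart i x) l ≠
        L (lift m (C.chart i x)) l * lift m (C.chart i x) k
  · -- if `L` moves the line of some `x`, no automorphism close to `1` is represented near `L`
    obtain ⟨x, hx, m, hm, k, l, hkl⟩ := hc
    have hev : Tendsto (fun q : P.aut × ((Fin (n + 1) → ℝ) →L[ℝ] (Fin (n + 1) → ℝ)) => q.1.1 x)
        (𝓝 (1, L)) (𝓝 x) :=
      ((continuous_aut_eval P).comp (continuous_fst.prodMk continuous_const)).tendsto (1, L)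
    have hch : Tendsto (fun q : P.aut × ((Fin (n + 1) → ℝ) →L[ℝ] (Fin (n + 1) → ℝ)) =>
        C.chart i (q.1.1 x)) (𝓝 (1, L)) (𝓝 (C.chart i x)) :=
      ((C.chart i).continuousAt (C.piece_subset i hx)).tendsto.comp hev
    have hw : Tendsto (fun q : P.aut × ((Fin (n + 1) → ℝ) →L[ℝ] (Fin (n + 1) → ℝ)) =>
        lift m (C.chart i (q.1.1 x))) (𝓝 (1, L)) (𝓝 (lift m (C.chart i x))) :=
      (contMDiffAt_lift hm).continuousAt.tendsto.comp hch
    have hLv : Tendsto (fun q : P.aut × ((Fin (n + 1) → ℝ) →L[ℝ] (Fin (n + 1) → ℝ)) =>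
        q.2 (lift m (C.chart i x))) (𝓝 (1, L)) (𝓝 (L (lift m (C.chart i x)))) :=
      (continuous_snd.clm_apply continuous_const).tendsto (1, L)
    have hne := (((tendsto_pi_nhds.1 hLv k).mul (tendsto_pi_nhds.1 hw l)).sub
      ((tendsto_pi_nhds.1 hLv l).mul (tendsto_pi_nhds.1 hw k))).eventually_ne (sub_ne_zero.2 hkl)
    filter_upwards [hne,
      hch.eventually ((isOpen_affDomain m).mem_nhds hm)] with q hq hqm hrep
    refine absurd (collinear_of_proj_eq (apply_ne_zero (L := (q.2 : _ →ₗ[ℝ] _)) hrep.injective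
      (lift_ne_zero m (C.chart i x))) (lift_ne_zero m (C.chart i (q.1.1 x))) ?_ k l)
      (sub_ne_zero.1 hq)
    rw [proj_lift hqm, hrep.chart_eq x hx, act_eq_proj_lift _ hm]
  · -- otherwise `L` fixes an open set of lines, hence is scalar
    push Not at hc
    obtain ⟨x, hx⟩ := (C.isConnected i).nonempty
    have hopen : ∀ᶠ p in 𝓝 (C.chart i x), ∃ y ∈ C.piece i, C.chart i y = p := by
      rw [← (C.chart i).map_nhds_eq (C.piece_subset i hx), eventually_map]
      filter_upwards [(C.isOpen i).mem_nhds hx] with y hy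
      exact ⟨y, hy, rfl⟩
    have hproj : Tendsto (proj (n := n)) (𝓝 (C.chart i x).rep) (𝓝 (C.chart i x)) := by
      have := (contMDiffAt_proj (C.chart i x).rep_nonzero).continuousAt.tendsto
      rwa [proj_rep] at this
    obtain ⟨c, hcL⟩ := exists_eq_smul_of_eventually_collinear
      (L := LinearMap.id) (K := (L : (Fin (n + 1) → ℝ) →ₗ[ℝ] (Fin (n + 1) → ℝ)))
      Function.injective_id (v := (C.chart i x).rep) (by
        filter_upwards [hproj.eventually hopen,
          continuousAt_id.eventually_ne (C.chart i x).rep_nonzero]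
        rintro v ⟨y, hy, hyv⟩ (hv : v ≠ 0) k l
        obtain ⟨m, hm⟩ := exists_mem_affDomain (C.chart i y)
        have h1 := hc y hy m hm l k
        rw [hyv] at hm h1
        obtain ⟨d, hd, h2⟩ := (proj_eq_proj_iff hv (lift_ne_zero m (proj v))).1 (proj_lift hm).symm
        set w := lift m (proj v)
        have h3 : L v = d • L w := by rw [h2, map_smul]
        simp only [LinearMap.id_apply, ContinuousLinearMap.coe_coe, h3]
        rw [h2]
        simp only [Pi.smul_apply, smul_eq_mul]
        linear_combination d * d * h1)
    have hcL' : L = c • 1 := by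
      ext1 v
      exact LinearMap.congr_fun hcL v
    have hc0 : c ≠ 0 := by
      rintro rfl
      rw [zero_smul] at hcL'
      simp [hcL'] at hL
    have htr : clmTrace n L ≠ 0 := by
      rw [hcL', map_smul, clmTrace_one]
      exact smul_ne_zero hc0 (by positivity)
    have hlim : Tendsto traceNormalize (𝓝 L) (𝓝 1) := by
      have := (continuousAt_traceNormalize htr).tendsto
      rwa [hcL', traceNormalize_smul_one hc0, ← hcL'] at this
    filter_upwards [continuousAt_snd.eventually (hlim.eventually hW),
      continuousAt_snd.eventually (continuous_clmTrace.continuousAt.eventually_ne htr)]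
      with q h1 h2 _
    exact ⟨h2, h1⟩

variable (C) in
theorem eventually_forall_mem_source : ∀ᶠ f in 𝓝 (1 : P.aut), ∀ x i, x ∈ C.piece i →
    f.1 x ∈ (C.chart i).source := by
  have := isCompact_univ.eventually_forall_of_forall_eventually (x₀ := (1 : P.aut)) (K := univ)
    (P := fun f x => ∀ i, x ∈ C.piece i → f.1 x ∈ (C.chart i).source) fun x _ => by
      refine eventually_all.2 fun i => ?_
      by_cases hi : x ∈ closure (C.piece i)
      · filter_upwards [(tendsto_aut_eval_one P x).eventually
          ((C.chart i).open_source.mem_nhds (C.closure_subset i hi))] with q hq _ using hq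
      · filter_upwards [continuousAt_snd.eventually (isClosed_closure.isOpen_compl.mem_nhds hi)]
          with q hq h1
        exact absurd (subset_closure h1) hq
  exact this.mono fun f hf x => hf x (mem_univ x)

variable (C) in
/-- An automorphism close to the identity moves the points so little that the same linear map is a
change of charts near a point and near its image. -/
theorem eventually_forall_exists_act_eq : ∀ᶠ f in 𝓝 (1 : P.aut), ∀ x i j, x ∈ C.piece i →
    x ∈ C.piece j → ∃ g : (Fin (n + 1) → ℝ) ≃ₗ[ℝ] (Fin (n + 1) → ℝ),
      (∀ᶠ y in 𝓝 x, C.chart j y = act g.toLinearMap (C.chart i y)) ∧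
      ∀ᶠ y in 𝓝 (f.1 x), C.chart j y = act g.toLinearMap (C.chart i y) := by
  have := isCompact_univ.eventually_forall_of_forall_eventually (x₀ := (1 : P.aut)) (K := univ)
    (P := fun f x => ∀ i j, x ∈ C.piece i →
    x ∈ C.piece j → ∃ g : (Fin (n + 1) → ℝ) ≃ₗ[ℝ] (Fin (n + 1) → ℝ),
      (∀ᶠ y in 𝓝 x, C.chart j y = act g.toLinearMap (C.chart i y)) ∧
      ∀ᶠ y in 𝓝 (f.1 x), C.chart j y = act g.toLinearMap (C.chart i y)) fun x _ => by
      refine eventually_all.2 fun i => eventually_all.2 fun j => ?_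
      by_cases hi : x ∈ closure (C.piece i)
      swap
      · filter_upwards [continuousAt_snd.eventually (isClosed_closure.isOpen_compl.mem_nhds hi)]
          with q hq h1
        exact absurd (subset_closure h1) hq
      by_cases hj : x ∈ closure (C.piece j)
      swap
      · filter_upwards [continuousAt_snd.eventually (isClosed_closure.isOpen_compl.mem_nhds hj)]
          with q hq _ h1
        exact absurd (subset_closure h1) hq
      obtain ⟨g, hg⟩ := C.exists_act_eq (C.closure_subset i hi) (C.closure_subset j hj)
      filter_upwards [(tendsto_aut_eval_one P x).eventually (eventually_eventually_nhds.2 hg),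
        continuousAt_snd.eventually (eventually_eventually_nhds.2 hg)] with q h1 h2 _ _
      exact ⟨g, h2, h1⟩
  exact this.mono fun f hf x => hf x (mem_univ x)

variable (C) in
/-- Every automorphism close to the identity comes from a section of the algebra close to `1`.
The representing endomorphisms, normalized by their traces, are intertwined by the changes of
charts because the trace is invariant under conjugation. -/
theorem eventually_exists_eq_toMap {U : Set C.symAlg} (hU : U ∈ 𝓝 1) :
    ∀ᶠ f in 𝓝 (1 : P.aut), ∃ a ∈ U, ∀ x, f.1 x = C.toMap a x := by
  obtain ⟨W, hW, hWU⟩ : ∃ W : C.ι → Set ((Fin (n + 1) → ℝ) →L[ℝ] (Fin (n + 1) → ℝ)),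
      (∀ i, W i ∈ 𝓝 1) ∧ ∀ a : C.symAlg, (∀ i, a.1 i ∈ W i) → a ∈ U := by
    obtain ⟨t, ht, htU⟩ := mem_nhds_induced _ _ _ |>.1 hU
    rw [nhds_pi, Filter.mem_pi] at ht
    obtain ⟨I, -, W, hW, hWt⟩ := ht
    exact ⟨W, hW, fun a ha => htU (hWt fun i _ => ha i)⟩
  filter_upwards [C.eventually_forall_mem_source, C.eventually_forall_exists_act_eq,
    eventually_all.2 fun i => eventually_traceNormalize_mem (C := C) i (hW i)] with f h1 h2 h3
  have h4 : ∀ i, ∃ L, C.Represents i f L ∧ clmTrace n L = n + 1 ∧ L ∈ W i := by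
    intro i
    obtain ⟨L, hL⟩ := exists_represents fun x hx => h1 x i hx
    have hL0 : ‖L‖ ≠ 0 := norm_ne_zero_iff.2 hL.ne_zero
    have hK := hL.smul (inv_ne_zero hL0)
    obtain ⟨h5, h6⟩ := h3 i _ (by
      rw [mem_sphere_zero_iff_norm, norm_smul, norm_inv, norm_norm, inv_mul_cancel₀ hL0]) hK
    exact ⟨_, hK.smul (div_ne_zero (by positivity) h5), clmTrace_traceNormalize h5, h6⟩
  choose L hL htr hLW using h4
  have hmem : L ∈ C.symAlg := by
    intro i j x hi hj g' hg' v
    obtain ⟨g, hg, hgf⟩ := h2 x i j hi hj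
    have hxi := C.piece_subset i hi
    obtain ⟨c, hc, hgg⟩ := exists_eq_smul_of_chart_eventuallyEq hxi g'.injective g.injective
      ((hg'.and hg).mono fun z hz => hz.1.symm.trans hz.2)
    obtain ⟨d, hd, hd'⟩ := exists_eq_smul_of_chart_eventuallyEq
      (L := g.toLinearMap ∘ₗ (L i : (Fin (n + 1) → ℝ) →ₗ[ℝ] (Fin (n + 1) → ℝ)))
      (K := (L j : (Fin (n + 1) → ℝ) →ₗ[ℝ] (Fin (n + 1) → ℝ)) ∘ₗ g.toLinearMap) hxi
      (g.injective.comp (hL i).injective) ((hL j).injective.comp g.injective) (by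
        filter_upwards [hg, f.1.continuous.continuousAt.eventually hgf,
          (C.isOpen i).mem_nhds hi, (C.isOpen j).mem_nhds hj] with y k1 k2 k3 k4
        rw [act_comp_of_injective _ (hL i).injective, act_comp_of_injective _ g.injective,
          ← (hL i).chart_eq y k3, ← k2, ← k1, (hL j).chart_eq y k4])
    -- `L j` is `d` times a conjugate of `L i`, and their traces agree and do not vanish
    have hconj : (L j : (Fin (n + 1) → ℝ) →ₗ[ℝ] (Fin (n + 1) → ℝ)) =
        d • g.conj (L i : (Fin (n + 1) → ℝ) →ₗ[ℝ] (Fin (n + 1) → ℝ)) := by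
      refine LinearMap.ext fun w => ?_
      have := LinearMap.congr_fun hd' (g.symm w)
      simpa using this
    have hd1 : d = 1 := by
      have e1 : (n : ℝ) + 1 = d * (n + 1) := by
        conv_lhs => rw [← htr j]
        rw [← htr i]
        change LinearMap.trace ℝ _ _ = d * LinearMap.trace ℝ _ _
        change LinearMap.trace ℝ _ (L j : (Fin (n + 1) → ℝ) →ₗ[ℝ] (Fin (n + 1) → ℝ)) =
          d * LinearMap.trace ℝ _ (L i : (Fin (n + 1) → ℝ) →ₗ[ℝ] (Fin (n + 1) → ℝ))
        rw [hconj, map_smul, LinearMap.trace_conj', smul_eq_mul]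
      have e2 : (n : ℝ) + 1 ≠ 0 := by positivity
      exact mul_right_cancel₀ e2 (by rw [← e1, one_mul])
    rw [hd1, one_smul] at hd'
    have e3 : ∀ w, g w = c • g' w := fun w => LinearMap.congr_fun hgg w
    have e4 : L j (g v) = g (L i v) := LinearMap.congr_fun hd' v
    rw [e3, e3, map_smul] at e4
    exact smul_right_injective _ hc e4
  refine ⟨⟨L, hmem⟩, hWU _ hLW, fun x => ?_⟩
  have hx := (C.cover x).choose_spec
  rw [toMap, localMap, ← (hL _).chart_eq x hx]
  exact ((C.chart _).left_inv ((hL _).mem_source x hx)).symm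

end

end GoodCover

/-! ### Immersed manifolds from families of plaques -/

/-- Charts of `M` centered on the points of a subset `O`, in each of which the slice `ℝᵖ × {0}`,
the plaque, is contained in `O`, such that any two plaques agree near their common points. -/
structure PlaqueFamily (n : ℕ) (M : Type u) [TopologicalSpace M]
    [ChartedSpace (EuclideanSpace ℝ (Fin n)) M] (p q : ℕ) (O : Set M) where
  /-- the splitting of the model space of `M` -/
  split : (EuclideanSpace ℝ (Fin p) × EuclideanSpace ℝ (Fin q)) ≃L[ℝ] EuclideanSpace ℝ (Fin n)
  /-- the charts of `M` -/
  chart : O → OpenPartialHomeomorph M (EuclideanSpace ℝ (Fin n))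
  chart_mem : ∀ x, chart x ∈ IsManifold.maximalAtlas (𝓡 n) ∞ M
  mem_source : ∀ x : O, x.1 ∈ (chart x).source
  center : ∀ x : O, (split.symm (chart x x.1)).2 = 0
  subset : ∀ x y, y ∈ (chart x).source → (split.symm (chart x y)).2 = 0 → y ∈ O
  compat : ∀ x x' y, y ∈ (chart x).source → (split.symm (chart x y)).2 = 0 →
    y ∈ (chart x').source → (split.symm (chart x' y)).2 = 0 →
    ∀ᶠ z in 𝓝 y, (split.symm (chart x z)).2 = 0 → (split.symm (chart x' z)).2 = 0

namespace PlaqueFamily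

variable {p q : ℕ} {O : Set M} (D : PlaqueFamily n M p q O)

/-- The plaque through a point of `O`. -/
def plaque (x : O) : Set M := {y | y ∈ (D.chart x).source ∧ (D.split.symm (D.chart x y)).2 = 0}

/-- The set `O`, as the underlying type of an immersed manifold. It is not given the subspace
topology. -/
def Leaf (_D : PlaqueFamily n M p q O) : Type u := O

/-- The inclusion of the leaf. -/
def incl (x : D.Leaf) : M := x.1

theorem incl_injective : Function.Injective D.incl := Subtype.val_injective

theorem incl_mem (x : D.Leaf) : D.incl x ∈ O := x.2

theorem range_incl : range D.incl = O := Subtype.range_val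

/-- The parametrization of a plaque. -/
def param (x : O) (t : EuclideanSpace ℝ (Fin p)) : M := (D.chart x).symm (D.split (t, 0))

variable {D} in
theorem chart_param {x : O} {t : EuclideanSpace ℝ (Fin p)}
    (h : D.split (t, 0) ∈ (D.chart x).target) : D.chart x (D.param x t) = D.split (t, 0) :=
  (D.chart x).right_inv h

variable {D} in
theorem param_mem_plaque {x : O} {t : EuclideanSpace ℝ (Fin p)}
    (h : D.split (t, 0) ∈ (D.chart x).target) : D.param x t ∈ D.plaque x := by
  refine ⟨(D.chart x).map_target h, ?_⟩
  rw [param, (D.chart x).right_inv h, ContinuousLinearEquiv.symm_apply_apply]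

/-- The coordinates on a plaque. -/
def coord (x : O) (y : M) : EuclideanSpace ℝ (Fin p) := (D.split.symm (D.chart x y)).1

variable {D} in
theorem split_coord {x : O} {y : M} (h : y ∈ D.plaque x) : D.split (D.coord x y, 0) =
    D.chart x y := by
  rw [coord, ← h.2]
  simp

variable {D} in
theorem param_coord {x : O} {y : M} (h : y ∈ D.plaque x) : D.param x (D.coord x y) = y := by
  rw [param, split_coord h, (D.chart x).left_inv h.1]

variable {D} in
theorem coord_param {x : O} {t : EuclideanSpace ℝ (Fin p)}
    (h : D.split (t, 0) ∈ (D.chart x).target) : D.coord x (D.param x t) = t := by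
  rw [coord, param, (D.chart x).right_inv h, ContinuousLinearEquiv.symm_apply_apply]

theorem isOpen_paramTarget (x : O) :
    IsOpen {t : EuclideanSpace ℝ (Fin p) | D.split (t, 0) ∈ (D.chart x).target} :=
  (D.chart x).open_target.preimage
    (D.split.continuous.comp (continuous_id.prodMk continuous_const))

variable {D} in
theorem contMDiffAt_param {x : O} {t : EuclideanSpace ℝ (Fin p)}
    (h : D.split (t, 0) ∈ (D.chart x).target) : ContMDiffAt (𝓡 p) (𝓡 n) ∞ (D.param x) t := by
  have h1 : ContDiff ℝ ∞ fun t : EuclideanSpace ℝ (Fin p) => D.split (t, 0) :=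
    D.split.contDiff.comp (contDiff_id.prodMk contDiff_const)
  exact (contMDiffAt_symm_of_mem_maximalAtlas (D.chart_mem x) h).comp t h1.contMDiff.contMDiffAt

variable {D} in
theorem contMDiffAt_coord {x : O} {y : M} (h : y ∈ (D.chart x).source) :
    ContMDiffAt (𝓡 n) (𝓡 p) ∞ (D.coord x) y := by
  have h1 : ContDiff ℝ ∞ fun w : EuclideanSpace ℝ (Fin n) => (D.split.symm w).1 :=
    contDiff_fst.comp D.split.symm.contDiff
  exact h1.contMDiff.contMDiffAt.comp y (contMDiffAt_of_mem_maximalAtlas (D.chart_mem x) h)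

theorem mem_plaque_self (x : O) : x.1 ∈ D.plaque x := ⟨D.mem_source x, D.center x⟩

variable {D} in
theorem eventually_mem_plaque {x x' : O} {y : M} (h : y ∈ D.plaque x) (h' : y ∈ D.plaque x') :
    ∀ᶠ z in 𝓝 y, z ∈ D.plaque x → z ∈ D.plaque x' := by
  filter_upwards [D.compat x x' y h.1 h.2 h'.1 h'.2, (D.chart x').open_source.mem_nhds h'.1]
    with z h1 h2 h3
  exact ⟨h2, h1 h3.2⟩

variable {D} in
theorem plaque_subset (x : O) : D.plaque x ⊆ O := fun y hy => D.subset x y hy.1 hy.2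

/-- A point of `O`, as a point of the leaf. -/
def toLeaf (x : O) : D.Leaf := x

open scoped Classical in
/-- The parametrization of a plaque, as a map to the leaf; constant outside of its domain. -/
def leafParam (x : O) (t : EuclideanSpace ℝ (Fin p)) : D.Leaf :=
  if h : D.split (t, 0) ∈ (D.chart x).target then
    D.toLeaf ⟨D.param x t, plaque_subset x (param_mem_plaque h)⟩ else D.toLeaf x

variable {D} in
theorem incl_leafParam {x : O} {t : EuclideanSpace ℝ (Fin p)}
    (h : D.split (t, 0) ∈ (D.chart x).target) : D.incl (D.leafParam x t) = D.param x t := by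
  rw [leafParam, dif_pos h]
  rfl

/-- The charts of the leaf, as partial equivalences. -/
def partialEquiv (x : O) : PartialEquiv D.Leaf (EuclideanSpace ℝ (Fin p)) where
  toFun y := D.coord x (D.incl y)
  invFun := D.leafParam x
  source := {y | D.incl y ∈ D.plaque x}
  target := {t | D.split (t, 0) ∈ (D.chart x).target}
  map_source' y hy := by
    change D.split (D.coord x (D.incl y), 0) ∈ (D.chart x).target
    rw [split_coord hy]
    exact (D.chart x).map_source hy.1
  map_target' t ht := by
    change D.incl (D.leafParam x t) ∈ D.plaque x
    rw [incl_leafParam ht]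
    exact param_mem_plaque ht
  left_inv' y hy := by
    have : D.split (D.coord x (D.incl y), 0) ∈ (D.chart x).target := by
      rw [split_coord hy]
      exact (D.chart x).map_source hy.1
    exact D.incl_injective ((incl_leafParam this).trans (param_coord hy))
  right_inv' t ht := by
    rw [incl_leafParam ht]
    exact coord_param ht

theorem incl_partialEquiv_symm {x : O} {t : EuclideanSpace ℝ (Fin p)}
    (h : D.split (t, 0) ∈ (D.chart x).target) :
    D.incl ((D.partialEquiv x).symm t) = D.param x t := incl_leafParam h

theorem mem_trans_source {x x' : O} {t : EuclideanSpace ℝ (Fin p)} :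
    t ∈ ((D.partialEquiv x).symm.trans (D.partialEquiv x')).source ↔
      D.split (t, 0) ∈ (D.chart x).target ∧ D.param x t ∈ D.plaque x' := by
  rw [PartialEquiv.trans_source, PartialEquiv.symm_source]
  refine and_congr_right fun h => ?_
  change D.incl ((D.partialEquiv x).symm t) ∈ D.plaque x' ↔ _
  rw [incl_partialEquiv_symm D h]

theorem contDiffOn_trans (x x' : O) :
    ContDiffOn ℝ ∞ ((D.partialEquiv x).symm.trans (D.partialEquiv x'))
      ((D.partialEquiv x).symm.trans (D.partialEquiv x')).source := by
  rw [← contMDiffOn_iff_contDiffOn]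
  have h : ContMDiffOn (𝓡 p) (𝓡 p) ∞ (D.coord x' ∘ D.param x)
      ((D.partialEquiv x).symm.trans (D.partialEquiv x')).source := fun t ht => by
    obtain ⟨h1, h2⟩ := (D.mem_trans_source).1 ht
    exact ((contMDiffAt_coord h2.1).comp t (contMDiffAt_param h1)).contMDiffWithinAt
  refine h.congr fun t ht => ?_
  obtain ⟨h1, h2⟩ := (D.mem_trans_source).1 ht
  change D.coord x' (D.incl ((D.partialEquiv x).symm t)) = _
  rw [incl_partialEquiv_symm D h1, Function.comp_apply]

/-- The atlas of the leaf. -/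
def core : ChartedSpaceCore (EuclideanSpace ℝ (Fin p)) D.Leaf where
  atlas := range D.partialEquiv
  chartAt x := D.partialEquiv x
  mem_chart_source x := D.mem_plaque_self x
  chart_mem_atlas x := mem_range_self (f := D.partialEquiv) x
  open_source := by
    rintro _ _ ⟨x, rfl⟩ ⟨x', rfl⟩
    rw [isOpen_iff_eventually]
    intro t ht
    obtain ⟨h1, h2⟩ := (D.mem_trans_source).1 ht
    filter_upwards [(D.isOpen_paramTarget x).mem_nhds h1,
      (contMDiffAt_param h1).continuousAt.eventually
        (eventually_mem_plaque (param_mem_plaque h1) h2)] with s h3 h4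
    exact (D.mem_trans_source).2 ⟨h3, h4 (param_mem_plaque h3)⟩
  continuousOn_toFun := by
    rintro _ _ ⟨x, rfl⟩ ⟨x', rfl⟩
    exact (D.contDiffOn_trans x x').continuousOn

instance : TopologicalSpace D.Leaf := D.core.toTopologicalSpace

instance : ChartedSpace (EuclideanSpace ℝ (Fin p)) D.Leaf := D.core.toChartedSpace

/-- The charts of the leaf, given by the coordinates on the plaques. -/
def leafChart (x : O) : OpenPartialHomeomorph D.Leaf (EuclideanSpace ℝ (Fin p)) :=
  D.core.openPartialHomeomorph (D.partialEquiv x) (mem_range_self x)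

theorem mem_leafChart_source {x : O} {y : D.Leaf} :
    y ∈ (D.leafChart x).source ↔ D.incl y ∈ D.plaque x := Iff.rfl

theorem incl_leafChart_symm {x : O} {t : EuclideanSpace ℝ (Fin p)}
    (h : t ∈ (D.leafChart x).target) : D.incl ((D.leafChart x).symm t) = D.param x t :=
  D.incl_partialEquiv_symm h

instance : IsManifold (𝓡 p) ∞ D.Leaf := by
  refine isManifold_of_contDiffOn (𝓡 p) ∞ D.Leaf ?_
  intro e e' he he'
  obtain ⟨_, ⟨⟨x, rfl⟩, rfl⟩⟩ := mem_iUnion₂.1 he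
  obtain ⟨_, ⟨⟨x', rfl⟩, rfl⟩⟩ := mem_iUnion₂.1 he'
  simp only [modelWithCornersSelf_coe, modelWithCornersSelf_coe_symm, Function.id_comp,
    Function.comp_id, range_id, inter_univ, preimage_id_eq, id_eq]
  exact D.contDiffOn_trans x x'

theorem leafChart_mem_maximalAtlas (x : O) :
    D.leafChart x ∈ IsManifold.maximalAtlas (𝓡 p) ∞ D.Leaf := by
  refine IsManifold.subset_maximalAtlas ?_
  exact chart_mem_atlas (EuclideanSpace ℝ (Fin p)) (D.toLeaf x)

theorem isImmersionOfComplement_incl : Manifold.IsImmersionOfComplement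
    (EuclideanSpace ℝ (Fin q)) (𝓡 p) (𝓡 n) ∞ D.incl := by
  intro x
  refine Manifold.IsImmersionAtOfComplement.mk_of_charts D.split (D.leafChart x) (D.chart x)
    (D.mem_plaque_self x) (D.mem_source x) (D.leafChart_mem_maximalAtlas x) (D.chart_mem x)
    (fun y hy => hy.1) fun t ht => ?_
  have ht' : t ∈ (D.leafChart x).target := by simpa using ht
  have h1 : D.chart x (D.incl ((D.leafChart x).symm t)) = D.split (t, 0) := by
    rw [D.incl_leafChart_symm ht']
    exact chart_param ht'
  simpa using h1

theorem isImmersion_incl : Manifold.IsImmersion (𝓡 p) (𝓡 n) ∞ D.incl :=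
  D.isImmersionOfComplement_incl.isImmersion

theorem contMDiff_incl : ContMDiff (𝓡 p) (𝓡 n) ∞ D.incl := D.isImmersion_incl.contMDiff

instance [T2Space M] : T2Space D.Leaf :=
  .of_injective_continuous D.incl_injective D.contMDiff_incl.continuous

variable {D} in
/-- A map to the leaf is continuous if it is continuous as a map to `M` and stays in a plaque. -/
theorem continuousAt_of_plaque {X : Type*} [TopologicalSpace X] {f : X → D.Leaf} {a : X} {x : O}
    (h1 : ContinuousAt (D.incl ∘ f) a) (h2 : D.incl (f a) ∈ D.plaque x)
    (h3 : ∀ᶠ b in 𝓝 a, D.incl (f b) ∈ D.plaque x) : ContinuousAt f a := by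
  rw [(D.leafChart x).continuousAt_iff_continuousAt_comp_left h3]
  exact ContinuousAt.comp (g := D.coord x) (contMDiffAt_coord h2.1).continuousAt h1

variable {D} in
/-- A map to the leaf is smooth if it is smooth as a map to `M` and stays in a plaque. -/
theorem contMDiffAt_of_plaque {E H N : Type*} [NormedAddCommGroup E] [NormedSpace ℝ E]
    [TopologicalSpace H] {I : ModelWithCorners ℝ E H} [TopologicalSpace N] [ChartedSpace H N]
    {f : N → D.Leaf} {a : N} {x : O}
    (h1 : ContMDiffAt I (𝓡 n) ∞ (D.incl ∘ f) a) (h2 : D.incl (f a) ∈ D.plaque x)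
    (h3 : ∀ᶠ b in 𝓝 a, D.incl (f b) ∈ D.plaque x) : ContMDiffAt I (𝓡 p) ∞ f a := by
  have h : ContMDiffAt I (𝓡 p) ∞ (fun b => (D.leafChart x).symm (D.coord x (D.incl (f b)))) a :=
    (contMDiffAt_symm_of_mem_maximalAtlas (D.leafChart_mem_maximalAtlas x)
      ((D.leafChart x).map_source (D.mem_leafChart_source.2 h2))).comp a
      (ContMDiffAt.comp a (g := D.coord x) (contMDiffAt_coord h2.1) h1)
  refine h.congr_of_eventuallyEq ?_
  filter_upwards [h3] with b hb
  exact ((D.leafChart x).left_inv hb).symm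

/-- A leaf is second countable as soon as it is the continuous image of a second countable space:
countably many plaques suffice to cover it. -/
theorem secondCountableTopology_leaf {X : Type*} [TopologicalSpace X] [SecondCountableTopology X]
    {f : X → D.Leaf} (hf : Continuous f) (hs : Function.Surjective f) :
    SecondCountableTopology D.Leaf := by
  obtain ⟨t, ht, h⟩ := TopologicalSpace.isOpen_iUnion_countable
    (fun x : D.Leaf => f ⁻¹' (chartAt (EuclideanSpace ℝ (Fin p)) x).source)
    fun x => (chartAt (EuclideanSpace ℝ (Fin p)) x).open_source.preimage hf
  refine ChartedSpace.secondCountable_of_countable_cover (EuclideanSpace ℝ (Fin p)) (s := t) ?_ ht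
  refine eq_univ_of_forall fun y => ?_
  obtain ⟨z, rfl⟩ := hs y
  have hz : z ∈ ⋃ x : D.Leaf, f ⁻¹' (chartAt (EuclideanSpace ℝ (Fin p)) x).source :=
    mem_iUnion.2 ⟨f z, mem_chart_source (EuclideanSpace ℝ (Fin p)) (f z)⟩
  rw [← h] at hz
  simpa using hz

end PlaqueFamily

namespace GoodCover

variable {P : ProjectiveStructure n M} (C : GoodCover P)

/-! ### The projective subspaces tangent to the orbits -/

theorem _root_.isOpenMap_rangeRestrict {A E : Type*} [NormedAddCommGroup A] [NormedSpace ℝ A]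
    [NormedAddCommGroup E] [NormedSpace ℝ E] [FiniteDimensional ℝ E] (f : A →ₗ[ℝ] E) :
    IsOpenMap f.rangeRestrict :=
  LinearMap.isOpenMap_of_finiteDimensional _ f.surjective_rangeRestrict

/-- The evaluation of the sections of the algebra on a vector, in the `i`-th chart. -/
def evalVec (i : C.ι) (v : Fin (n + 1) → ℝ) : C.symAlg →ₗ[ℝ] (Fin (n + 1) → ℝ) where
  toFun a := a.1 i v
  map_add' _ _ := rfl
  map_smul' _ _ := rfl

/-- The linear subspace of the values of the sections of the algebra on a vector. Its
projectivization is, near the line spanned by the vector, the image of an orbit in the chart. -/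
def vecSpace (i : C.ι) (v : Fin (n + 1) → ℝ) : Submodule ℝ (Fin (n + 1) → ℝ) :=
  LinearMap.range (C.evalVec i v)

variable {C}

theorem apply_mem_vecSpace (a : C.symAlg) (i : C.ι) (v : Fin (n + 1) → ℝ) :
    a.1 i v ∈ C.vecSpace i v := ⟨a, rfl⟩

theorem self_mem_vecSpace (i : C.ι) (v : Fin (n + 1) → ℝ) : v ∈ C.vecSpace i v :=
  apply_mem_vecSpace 1 i v

theorem vecSpace_le {i : C.ι} {v w : Fin (n + 1) → ℝ} (h : w ∈ C.vecSpace i v) :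
    C.vecSpace i w ≤ C.vecSpace i v := by
  obtain ⟨a, rfl⟩ := h
  rintro _ ⟨b, rfl⟩
  exact ⟨b * a, rfl⟩

theorem vecSpace_smul {i : C.ι} {v : Fin (n + 1) → ℝ} {c : ℝ} (hc : c ≠ 0) :
    C.vecSpace i (c • v) = C.vecSpace i v := by
  refine le_antisymm (vecSpace_le (Submodule.smul_mem _ c (self_mem_vecSpace i v)))
    (vecSpace_le ?_)
  have := Submodule.smul_mem _ c⁻¹ (self_mem_vecSpace i (c • v))
  rwa [smul_smul, inv_mul_cancel₀ hc, one_smul] at this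

theorem vecSpace_map {i j : C.ι} {x : M} (hi : x ∈ C.piece i) (hj : x ∈ C.piece j)
    {g : (Fin (n + 1) → ℝ) ≃ₗ[ℝ] (Fin (n + 1) → ℝ)}
    (hg : ∀ᶠ y in 𝓝 x, C.chart j y = act g.toLinearMap (C.chart i y)) (v : Fin (n + 1) → ℝ) :
    C.vecSpace j (g v) = (C.vecSpace i v).map g.toLinearMap := by
  ext w
  constructor
  · rintro ⟨a, rfl⟩
    exact ⟨a.1 i v, apply_mem_vecSpace a i v, (C.symAlg_apply a hi hj hg v).symm⟩
  · rintro ⟨_, ⟨a, rfl⟩, rfl⟩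
    exact ⟨a, C.symAlg_apply a hi hj hg v⟩

variable (C) in
/-- The linear subspace whose projectivization is the image of the orbit of a point, near this
point, in the `i`-th chart. -/
def orbitSpace (i : C.ι) (x : M) : Submodule ℝ (Fin (n + 1) → ℝ) :=
  C.vecSpace i (C.chart i x).rep

theorem vecSpace_eq_orbitSpace {i : C.ι} {x : M} {v : Fin (n + 1) → ℝ} (hv : v ≠ 0)
    (h : C.chart i x = proj v) : C.vecSpace i v = C.orbitSpace i x := by
  obtain ⟨c, hc, h1⟩ := exists_rep_proj hv
  rw [orbitSpace, h, h1, vecSpace_smul hc]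

theorem orbitSpace_map {i j : C.ι} {x : M} (hi : x ∈ C.piece i) (hj : x ∈ C.piece j)
    {g : (Fin (n + 1) → ℝ) ≃ₗ[ℝ] (Fin (n + 1) → ℝ)}
    (hg : ∀ᶠ y in 𝓝 x, C.chart j y = act g.toLinearMap (C.chart i y)) :
    C.orbitSpace j x = (C.orbitSpace i x).map g.toLinearMap := by
  rw [orbitSpace.eq_1 C i, ← vecSpace_map hi hj hg]
  exact (vecSpace_eq_orbitSpace (apply_ne_zero (L := g.toLinearMap) g.injective
    (C.chart i x).rep_nonzero) hg.self_of_nhds).symm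

variable (C) in
/-- The dimension of the orbit of a point, plus one. -/
def rank (x : M) : ℕ := Module.finrank ℝ (C.orbitSpace (C.cover x).choose x)

theorem finrank_orbitSpace {i : C.ι} {x : M} (hi : x ∈ C.piece i) :
    Module.finrank ℝ (C.orbitSpace i x) = C.rank x := by
  have hj := (C.cover x).choose_spec
  obtain ⟨g, hg⟩ := C.exists_act_eq (C.piece_subset _ hi) (C.piece_subset _ hj)
  rw [rank, orbitSpace_map hi hj hg]
  exact (LinearEquiv.finrank_map_eq g _).symm

theorem rank_pos (x : M) : 0 < C.rank x := by
  rw [rank, Module.finrank_pos_iff]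
  exact nontrivial_of_ne (⟨_, self_mem_vecSpace _ _⟩ : C.orbitSpace (C.cover x).choose x) 0
    fun h => (C.chart _ x).rep_nonzero (congrArg Subtype.val h)

theorem rank_le (x : M) : C.rank x ≤ n + 1 := by
  have := Submodule.finrank_le (C.orbitSpace (C.cover x).choose x)
  rwa [Module.finrank_fin_fun] at this

/-- The spaces of the values of the sections decrease along a plaque, hence are constant if their
dimension is. -/
theorem orbitSpace_eq {i : C.ι} {x y : M} (hx : x ∈ C.piece i) (hy : y ∈ C.piece i)
    (h : (C.chart i y).rep ∈ C.orbitSpace i x) (hr : C.rank y = C.rank x) :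
    C.orbitSpace i y = C.orbitSpace i x :=
  Submodule.eq_of_le_of_finrank_eq (vecSpace_le h) (by
    rw [finrank_orbitSpace hx, finrank_orbitSpace hy, hr])

theorem Integrable.rep_toMap_mem {a : C.symAlg} (ha : C.Integrable a) {i : C.ι} {x : M}
    (hx : x ∈ C.piece i) : (C.chart i (C.toMap a x)).rep ∈ C.orbitSpace i x := by
  rw [ha.chart_toMap hx, act]
  exact (rep_proj_mem_iff ((ha x i hx).1.apply_ne_zero (C.chart i x).rep_nonzero)).2
    (apply_mem_vecSpace a i _)

theorem tendsto_symAlg_prodMk (x : M) :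
    Tendsto (fun a : C.symAlg => (a, x)) (𝓝 (1 : C.symAlg)) (𝓝 (1, x)) :=
  (Continuous.prodMk_left x).tendsto (1 : C.symAlg)

theorem tendsto_toMap_left [CompactSpace M] (x : M) :
    Tendsto (fun a : C.symAlg => C.toMap a x) (𝓝 (1 : C.symAlg)) (𝓝 x) := by
  have := (tendsto_toMap_one x).comp (tendsto_symAlg_prodMk (C := C) x)
  exact this

theorem eventually_rank_toMap [CompactSpace M] (x : M) :
    ∀ᶠ a in 𝓝 (1 : C.symAlg), C.rank (C.toMap a x) = C.rank x := by
  obtain ⟨i, hi⟩ := C.cover x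
  filter_upwards [eventually_exists_inverse (A := C.symAlg) univ univ_mem,
    C.eventually_integrable, (tendsto_toMap_left x).eventually ((C.isOpen i).mem_nhds hi)]
  rintro a ⟨b, -, -, hba⟩ ha h1
  rw [← finrank_orbitSpace hi, ← finrank_orbitSpace h1]
  have h2 : C.orbitSpace i (C.toMap a x) = C.vecSpace i (a.1 i (C.chart i x).rep) :=
    (vecSpace_eq_orbitSpace ((ha x i hi).1.apply_ne_zero (C.chart i x).rep_nonzero)
      (ha.chart_toMap hi)).symm
  have h3 : C.orbitSpace i (C.toMap a x) = C.orbitSpace i x := by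
    rw [h2]
    refine le_antisymm (vecSpace_le (apply_mem_vecSpace a i _)) (vecSpace_le ?_)
    have h4 := apply_mem_vecSpace b i (a.1 i (C.chart i x).rep)
    have h5 : b.1 i (a.1 i (C.chart i x).rep) = (b * a).1 i (C.chart i x).rep := rfl
    rw [h5, hba] at h4
    exact h4
  rw [h3]

variable (C) in
/-- The points near `x` on the projective subspace of the orbit of `x` are images of `x` under the
maps defined by the sections of the algebra close to `1`, since evaluation of the sections on a
vector is an open map onto the subspace of the values. -/
theorem eventually_exists_toMap_eq [CompactSpace M] {i : C.ι} {x : M} (hi : x ∈ C.piece i)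
    {U : Set C.symAlg} (hU : U ∈ 𝓝 1) :
    ∀ᶠ z in 𝓝 x, (C.chart i z).rep ∈ C.orbitSpace i x → ∃ a ∈ U, C.toMap a x = z := by
  have hopen : IsOpenMap (C.evalVec i (C.chart i x).rep).rangeRestrict :=
    isOpenMap_rangeRestrict (A := C.symAlg) _
  have h1 := hopen.image_mem_nhds (inter_mem hU C.eventually_integrable)
  obtain ⟨T, hT, hTs⟩ := mem_nhds_induced _ _ _ |>.1 h1
  replace hT : T ∈ 𝓝 (C.chart i x).rep := hT
  obtain ⟨m, hm⟩ := exists_mem_affDomain (C.chart i x)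
  obtain ⟨c, hc, hcv⟩ := (proj_eq_proj_iff (C.chart i x).rep_nonzero
    (lift_ne_zero m (C.chart i x))).1 (by rw [proj_rep, proj_lift hm])
  have hch := (C.chart i).continuousAt (C.piece_subset i hi)
  have hw : Tendsto (fun z => c • lift m (C.chart i z)) (𝓝 x) (𝓝 (C.chart i x).rep) := by
    conv_rhs => rw [hcv]
    exact ((contMDiffAt_lift hm).continuousAt.tendsto.comp hch).const_smul c
  filter_upwards [hw.eventually hT, hch.eventually ((isOpen_affDomain m).mem_nhds hm),
    (C.chart i).open_source.mem_nhds (C.piece_subset i hi)] with z hz hzm hzs hzW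
  have h2 : proj (c • lift m (C.chart i z)) = C.chart i z := by rw [proj_smul hc, proj_lift hzm]
  have h3 : c • lift m (C.chart i z) ∈ C.orbitSpace i x := by
    rwa [← rep_proj_mem_iff (smul_ne_zero hc (lift_ne_zero m _)), h2]
  obtain ⟨a, ⟨haU, ha⟩, haz⟩ := hTs (show (⟨_, h3⟩ : C.orbitSpace i x) ∈ _ from hz)
  refine ⟨a, haU, (C.chart i).injOn (Integrable.toMap_mem ha hi) hzs ?_⟩
  rw [Integrable.chart_toMap ha hi, ← h2]
  exact congrArg proj (congrArg Subtype.val haz)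

end GoodCover

/-! ### The orbits as immersed projective submanifolds -/

theorem ProjectiveStructure.mem_orbit_self (P : ProjectiveStructure n M) (x : M) : x ∈ P.orbit x :=
  ⟨1, P.autZero.one_mem, rfl⟩

theorem ProjectiveStructure.mem_orbit_trans {P : ProjectiveStructure n M} {x y z : M}
    (hxy : y ∈ P.orbit x) (hyz : z ∈ P.orbit y) : z ∈ P.orbit x := by
  obtain ⟨f, hf, rfl⟩ := hxy
  obtain ⟨g, hg, rfl⟩ := hyz
  exact ⟨g * f, P.autZero.mul_mem hg hf, rfl⟩

theorem ProjectiveStructure.mem_orbit_symm {P : ProjectiveStructure n M} {x y : M}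
    (hxy : y ∈ P.orbit x) : x ∈ P.orbit y := by
  obtain ⟨f, hf, rfl⟩ := hxy
  exact ⟨f⁻¹, P.autZero.inv_mem hf, f.1.symm_apply_apply x⟩

theorem ProjectiveStructure.tendsto_mul_inv_aut (P : ProjectiveStructure n M) (f : P.aut) :
    Tendsto (fun g : P.aut => g * f⁻¹) (𝓝 f) (𝓝 1) := by
  have h0 : Continuous P.autToContinuousMap := continuous_induced_dom
  have h : Continuous fun g : P.aut => g * f⁻¹ :=
    continuous_induced_rng.2
      ((ContinuousMap.continuous_precomp (P.autToContinuousMap f⁻¹)).comp h0)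
  have h1 := h.tendsto f
  rwa [mul_inv_cancel] at h1

namespace GoodCover

variable {P : ProjectiveStructure n M}

theorem eventually_exists_eq_toMap_comp [T2Space M] [CompactSpace M] (C : GoodCover P)
    {U : Set C.symAlg} (hU : U ∈ 𝓝 1) (f : P.aut) :
    ∀ᶠ g in 𝓝 f, ∃ a ∈ U, ∀ x, g.1 x = C.toMap a (f.1 x) := by
  filter_upwards [(P.tendsto_mul_inv_aut f).eventually (C.eventually_exists_eq_toMap hU)]
  rintro g ⟨a, ha, h⟩
  refine ⟨a, ha, fun x => ?_⟩
  rw [← h]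
  exact congrArg g.1 (f.1.symm_apply_apply x).symm

theorem eventually_rank_aut [T2Space M] [CompactSpace M] (C : GoodCover P) (x : M) (g : P.aut) :
    ∀ᶠ k in 𝓝 g, C.rank (k.1 x) = C.rank (g.1 x) := by
  have h : {a : C.symAlg | C.rank (C.toMap a (g.1 x)) = C.rank (g.1 x)} ∈ 𝓝 (1 : C.symAlg) :=
    eventually_rank_toMap (g.1 x)
  filter_upwards [C.eventually_exists_eq_toMap_comp h g]
  rintro k ⟨a, ha, hk⟩
  exact (congrArg C.rank (hk x)).trans ha

/-- The rank is locally constant on the automorphism group, hence constant on its identity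
component. -/
theorem rank_eq_of_mem_orbit [T2Space M] [CompactSpace M] (C : GoodCover P) {x y : M}
    (h : y ∈ P.orbit x) : C.rank y = C.rank x := by
  obtain ⟨f, hf, rfl⟩ := h
  have hc : IsLocallyConstant fun g : P.aut => C.rank (g.1 x) :=
    (IsLocallyConstant.iff_eventually_eq _).2 (C.eventually_rank_aut x)
  have hf' : f ∈ connectedComponent (1 : P.aut) := hf
  have h1 : C.rank (f.1 x) = C.rank ((1 : P.aut).1 x) :=
    hc.apply_eq_of_isPreconnected isPreconnected_connectedComponent hf' mem_connectedComponent
  exact h1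

theorem eventually_toMap_mem_orbit [CompactSpace M] (C : GoodCover P) :
    ∀ᶠ a in 𝓝 (1 : C.symAlg), ∀ x, C.toMap a x ∈ P.orbit x :=
  C.eventually_exists_autZero.mono fun _ ⟨f, hf, h⟩ x => ⟨f, hf, h x⟩

/-- A chart of `M` around a point `y` in which the orbit of `y` is locally a coordinate subspace,
with a linear parametrization of the corresponding projective subspace in a projective chart. -/
structure AdaptedChart (C : GoodCover P) {p q : ℕ}
    (T : (EuclideanSpace ℝ (Fin p) × EuclideanSpace ℝ (Fin q)) ≃L[ℝ] EuclideanSpace ℝ (Fin n))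
    (y : M) where
  /-- the index of the projective chart -/
  idx : C.ι
  mem_piece : y ∈ C.piece idx
  /-- the adapted chart -/
  chart : OpenPartialHomeomorph M (EuclideanSpace ℝ (Fin n))
  chart_mem : chart ∈ IsManifold.maximalAtlas (𝓡 n) ∞ M
  mem_source : y ∈ chart.source
  chart_self : chart y = 0
  source_subset : chart.source ⊆ C.piece idx
  snd_eq_zero_iff : ∀ z ∈ chart.source,
    (T.symm (chart z)).2 = 0 ↔ (C.chart idx z).rep ∈ C.orbitSpace idx y
  mem_orbit : ∀ z ∈ chart.source, (T.symm (chart z)).2 = 0 → z ∈ P.orbit y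
  /-- the linear parametrization of the projective subspace -/
  linear : (Fin (p + 1) → ℝ) →ₗ[ℝ] (Fin (n + 1) → ℝ)
  linear_injective : Function.Injective linear
  range_linear : LinearMap.range linear = C.orbitSpace idx y
  linear_homog : linear (homog 0 0) = (C.chart idx y).rep
  chart_eq : ∀ z ∈ chart.source, (T.symm (chart z)).2 = 0 →
    C.chart idx z = proj (linear (homog 0 (T.symm (chart z)).1))

theorem nonempty_adaptedChart [IsManifold (𝓡 n) ∞ M] [CompactSpace M] (C : GoodCover P) {p q : ℕ}
    (T : (EuclideanSpace ℝ (Fin p) × EuclideanSpace ℝ (Fin q)) ≃L[ℝ] EuclideanSpace ℝ (Fin n))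
    (hpq : p + q = n) {y : M} (hy : C.rank y = p + 1) : Nonempty (C.AdaptedChart T y) := by
  obtain ⟨i, hi⟩ := C.cover y
  have hv := (C.chart i y).rep_nonzero
  obtain ⟨Ψ, hΨ, h1, h2, h3, L, hL, h4, h5, h6⟩ := exists_adaptedChart T hv
    (self_mem_vecSpace i _) ((finrank_orbitSpace hi).trans hy) hpq
  rw [proj_rep] at h1 h2
  obtain ⟨S, hS, hSo, hyS⟩ := eventually_nhds_iff.1
    ((C.eventually_exists_toMap_eq hi C.eventually_toMap_mem_orbit).and ((C.isOpen i).mem_nhds hi))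
  have hs : ∀ z, z ∈ (((C.chart i).trans Ψ).restr S).source →
      (z ∈ (C.chart i).source ∧ C.chart i z ∈ Ψ.source) ∧ z ∈ S := by
    intro z hz
    rw [OpenPartialHomeomorph.restr_source' _ _ hSo, OpenPartialHomeomorph.trans_source] at hz
    exact hz
  have hmem : (C.chart i).trans Ψ ∈ IsManifold.maximalAtlas (𝓡 n) ∞ M := by
    refine OpenPartialHomeomorph.mem_maximalAtlas_of_contMDiffOn _ ?_ ?_
    · exact (contMDiffOn_of_mem_maximalAtlas hΨ).comp
        ((P.contMDiffOn _ (C.chart_mem i)).mono fun z hz => hz.1) fun z hz => hz.2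
    · exact (P.contMDiffOn_symm _ (C.chart_mem i)).comp
        ((contMDiffOn_symm_of_mem_maximalAtlas hΨ).mono fun z hz => hz.1) fun z hz => hz.2
  have hiff : ∀ z ∈ (((C.chart i).trans Ψ).restr S).source,
      (T.symm (((C.chart i).trans Ψ).restr S z)).2 = 0 ↔
        (C.chart i z).rep ∈ C.orbitSpace i y := fun z hz => h3 _ (hs z hz).1.2
  exact ⟨{
    idx := i
    mem_piece := hi
    chart := ((C.chart i).trans Ψ).restr S
    chart_mem := restr_mem_maximalAtlas _ hmem hSo
    mem_source := by
      rw [OpenPartialHomeomorph.restr_source' _ _ hSo]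
      exact ⟨⟨C.piece_subset i hi, h1⟩, hyS⟩
    chart_self := h2
    source_subset := fun z hz => (hS z (hs z hz).2).2
    snd_eq_zero_iff := hiff
    mem_orbit := fun z hz hz0 => by
      obtain ⟨a, ha, rfl⟩ := (hS z (hs z hz).2).1 ((hiff z hz).1 hz0)
      exact ha y
    linear := L
    linear_injective := hL
    range_linear := h4
    linear_homog := h5
    chart_eq := fun z hz hz0 => h6 _ (hs z hz).1.2 ((hiff z hz).1 hz0) }⟩

/-- Near a point of an orbit, the condition to be on the projective subspace of the orbit does not
depend on the projective chart. -/
theorem eventually_rep_mem_imp (C : GoodCover P) {i j : C.ι} {y : M} (hi : y ∈ C.piece i)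
    (hj : y ∈ C.piece j) :
    ∀ᶠ z in 𝓝 y, (C.chart i z).rep ∈ C.orbitSpace i y → (C.chart j z).rep ∈ C.orbitSpace j y := by
  obtain ⟨g, hg⟩ := C.exists_act_eq (C.piece_subset i hi) (C.piece_subset j hj)
  filter_upwards [hg] with z hz h
  rw [hz, orbitSpace_map hi hj hg, rep_act_mem_map_iff g.injective]
  exact h

section Orbit

variable [IsManifold (𝓡 n) ∞ M] [T2Space M] [CompactSpace M] (C : GoodCover P) {p q : ℕ}
  (T : (EuclideanSpace ℝ (Fin p) × EuclideanSpace ℝ (Fin q)) ≃L[ℝ] EuclideanSpace ℝ (Fin n))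
  (hpq : p + q = n) {x : M} (hx : C.rank x = p + 1)

/-- A choice of an adapted chart around each point of an orbit. -/
def adaptedChart (y : P.orbit x) : C.AdaptedChart T y.1 :=
  (C.nonempty_adaptedChart T hpq ((C.rank_eq_of_mem_orbit y.2).trans hx)).some

variable {C T hpq hx} in
theorem orbitSpace_eq_of_mem {y : P.orbit x} {z : M}
    (hz : z ∈ (C.adaptedChart T hpq hx y).chart.source)
    (hz0 : (T.symm ((C.adaptedChart T hpq hx y).chart z)).2 = 0) :
    C.orbitSpace (C.adaptedChart T hpq hx y).idx z =
      C.orbitSpace (C.adaptedChart T hpq hx y).idx y := by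
  set A := C.adaptedChart T hpq hx y
  exact orbitSpace_eq A.mem_piece (A.source_subset hz) ((A.snd_eq_zero_iff z hz).1 hz0)
    (C.rank_eq_of_mem_orbit (A.mem_orbit z hz hz0))

/-- The plaques of an orbit. -/
def orbitPlaques : PlaqueFamily n M p q (P.orbit x) where
  split := T
  chart y := (C.adaptedChart T hpq hx y).chart
  chart_mem y := (C.adaptedChart T hpq hx y).chart_mem
  mem_source y := (C.adaptedChart T hpq hx y).mem_source
  center y := by
    rw [(C.adaptedChart T hpq hx y).chart_self]
    simp
  subset y z hz hz0 := P.mem_orbit_trans y.2 ((C.adaptedChart T hpq hx y).mem_orbit z hz hz0)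
  compat y y' z hz hz0 hz' hz0' := by
    have h1 := orbitSpace_eq_of_mem hz hz0
    have h2 := orbitSpace_eq_of_mem hz' hz0'
    set A := C.adaptedChart T hpq hx y
    set A' := C.adaptedChart T hpq hx y'
    filter_upwards [C.eventually_rep_mem_imp (A.source_subset hz) (A'.source_subset hz'),
      A.chart.open_source.mem_nhds hz, A'.chart.open_source.mem_nhds hz'] with w k1 k2 k3 k4
    rw [A.snd_eq_zero_iff w k2, ← h1] at k4
    rw [A'.snd_eq_zero_iff w k3, ← h2]
    exact k1 k4

theorem eventually_toMap_mem_plaque (y : P.orbit x) :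
    ∀ᶠ a in 𝓝 (1 : C.symAlg), C.toMap a y.1 ∈ (C.orbitPlaques T hpq hx).plaque y := by
  set A := C.adaptedChart T hpq hx y
  filter_upwards [C.eventually_integrable,
    (tendsto_toMap_left (C := C) y.1).eventually (A.chart.open_source.mem_nhds A.mem_source)]
    with a ha h1
  exact ⟨h1, (A.snd_eq_zero_iff _ h1).2 (ha.rep_toMap_mem A.mem_piece)⟩

/-- The orbit map from the identity component of the automorphism group to a leaf. -/
def orbitMap (f : P.autZero) : (C.orbitPlaques T hpq hx).Leaf :=
  (C.orbitPlaques T hpq hx).toLeaf ⟨f.1.1 x, f.1, f.2, rfl⟩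

/-- The orbit map is continuous for the leaf topology: an automorphism close to `f` differs from `f`
by a section of the algebra close to `1`, which moves a point inside its plaque. -/
theorem continuous_orbitMap : Continuous (C.orbitMap T hpq hx) := by
  refine continuous_iff_continuousAt.2 fun f => ?_
  set y : P.orbit x := ⟨f.1.1 x, f.1, f.2, rfl⟩
  refine PlaqueFamily.continuousAt_of_plaque (x := y) ?_
    ((C.orbitPlaques T hpq hx).mem_plaque_self y) ?_
  · have h : Continuous fun g : P.autZero => g.1.1 x :=
      (continuous_aut_eval P).comp (continuous_subtype_val.prodMk continuous_const)
    exact h.continuousAt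
  · filter_upwards [continuousAt_subtype_val.eventually (C.eventually_exists_eq_toMap_comp
      (C.eventually_toMap_mem_plaque T hpq hx y) f.1)]
    rintro g ⟨a, ha, h⟩
    have h1 : (C.orbitPlaques T hpq hx).incl (C.orbitMap T hpq hx g) = C.toMap a y.1 := h x
    rw [h1]
    exact ha

theorem surjective_orbitMap : Function.Surjective (C.orbitMap T hpq hx) := by
  rintro ⟨_, f, hf, rfl⟩
  exact ⟨⟨f, hf⟩, rfl⟩

theorem secondCountableTopology_orbit :
    SecondCountableTopology (C.orbitPlaques T hpq hx).Leaf := by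
  have : SecondCountableTopology M :=
    ChartedSpace.secondCountable_of_sigmaCompact (EuclideanSpace ℝ (Fin n)) M
  have : SecondCountableTopology P.aut :=
    TopologicalSpace.secondCountableTopology_induced _ _ P.autToContinuousMap
  have : SecondCountableTopology P.autZero :=
    TopologicalSpace.secondCountableTopology_induced _ P.aut Subtype.val
  exact PlaqueFamily.secondCountableTopology_leaf _ (C.continuous_orbitMap T hpq hx)
    (C.surjective_orbitMap T hpq hx)

theorem connectedSpace_orbit : ConnectedSpace (C.orbitPlaques T hpq hx).Leaf := by
  have : ConnectedSpace P.autZero := Subtype.connectedSpace isConnected_connectedComponent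
  exact (C.surjective_orbitMap T hpq hx).connectedSpace (C.continuous_orbitMap T hpq hx)

/-- The projective charts of an orbit. -/
def orbitChart (y : P.orbit x) :
    OpenPartialHomeomorph (C.orbitPlaques T hpq hx).Leaf (RealProj p) :=
  ((C.orbitPlaques T hpq hx).leafChart y).trans (affChart 0).symm

variable {C T hpq hx}

theorem mem_orbitChart_source {y : P.orbit x} {z : (C.orbitPlaques T hpq hx).Leaf} :
    z ∈ (C.orbitChart T hpq hx y).source ↔
      (C.orbitPlaques T hpq hx).incl z ∈ (C.orbitPlaques T hpq hx).plaque y := by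
  rw [orbitChart, OpenPartialHomeomorph.trans_source]
  exact and_iff_left (mem_univ _)

theorem orbitChart_apply (y : P.orbit x) (z : (C.orbitPlaques T hpq hx).Leaf) :
    C.orbitChart T hpq hx y z =
      proj (homog 0 ((C.orbitPlaques T hpq hx).coord y ((C.orbitPlaques T hpq hx).incl z))) :=
  (proj_of_ne_zero (homog_ne_zero _ _)).symm

theorem chart_incl {y : P.orbit x} {z : (C.orbitPlaques T hpq hx).Leaf}
    (hz : z ∈ (C.orbitChart T hpq hx y).source) :
    C.chart (C.adaptedChart T hpq hx y).idx ((C.orbitPlaques T hpq hx).incl z) =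
      act (C.adaptedChart T hpq hx y).linear (C.orbitChart T hpq hx y z) := by
  have hz' := mem_orbitChart_source.1 hz
  rw [orbitChart_apply, act_proj _ (homog_ne_zero _ _)]
  exact (C.adaptedChart T hpq hx y).chart_eq _ hz'.1 hz'.2

theorem _root_.exists_linearEquiv_comp_eq {V W : Type*} [AddCommGroup V] [Module ℝ V]
    [AddCommGroup W] [Module ℝ W] {A B : V →ₗ[ℝ] W} (hA : Function.Injective A)
    (hB : Function.Injective B) (h : LinearMap.range A = LinearMap.range B) :
    ∃ g : V ≃ₗ[ℝ] V, ∀ v, B (g v) = A v := by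
  refine ⟨(LinearEquiv.ofInjective A hA).trans ((LinearEquiv.ofEq _ _ h).trans
    (LinearEquiv.ofInjective B hB).symm), fun v => ?_⟩
  have := congrArg Subtype.val ((LinearEquiv.ofInjective B hB).apply_symm_apply
    (LinearEquiv.ofEq _ _ h (LinearEquiv.ofInjective A hA v)))
  exact this

variable (C T hpq hx)

/-- The projective structure of an orbit. -/
def orbitProjectiveStructure : ProjectiveStructure p (C.orbitPlaques T hpq hx).Leaf where
  charts := range (C.orbitChart T hpq hx)
  cover z := ⟨_, mem_range_self (⟨_, (C.orbitPlaques T hpq hx).incl_mem z⟩ : P.orbit x),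
    mem_orbitChart_source.2 ((C.orbitPlaques T hpq hx).mem_plaque_self _)⟩
  contMDiffOn := by
    rintro _ ⟨y, rfl⟩
    exact (contMDiffOn_symm_of_mem_maximalAtlas (affChart_mem_maximalAtlas 0)).comp
      ((contMDiffOn_of_mem_maximalAtlas
        ((C.orbitPlaques T hpq hx).leafChart_mem_maximalAtlas y)).mono fun z hz => hz.1)
      fun z hz => hz.2
  contMDiffOn_symm := by
    rintro _ ⟨y, rfl⟩
    exact (contMDiffOn_symm_of_mem_maximalAtlas
      ((C.orbitPlaques T hpq hx).leafChart_mem_maximalAtlas y)).comp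
      ((contMDiffOn_of_mem_maximalAtlas (affChart_mem_maximalAtlas 0)).mono fun z hz => hz.1)
      fun z hz => hz.2
  compat := by
    rintro _ ⟨y, rfl⟩ _ ⟨y', rfl⟩ z ⟨hz, hz'⟩
    have k1 := mem_orbitChart_source.1 hz
    have k1' := mem_orbitChart_source.1 hz'
    have h1 := orbitSpace_eq_of_mem k1.1 k1.2
    have h2 := orbitSpace_eq_of_mem k1'.1 k1'.2
    have hi := (C.adaptedChart T hpq hx y).source_subset k1.1
    have hj := (C.adaptedChart T hpq hx y').source_subset k1'.1
    obtain ⟨g, hg⟩ := C.exists_act_eq (C.piece_subset _ hi) (C.piece_subset _ hj)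
    have hinj := g.injective.comp (C.adaptedChart T hpq hx y).linear_injective
    obtain ⟨h, hh⟩ := exists_linearEquiv_comp_eq
      (A := g.toLinearMap ∘ₗ (C.adaptedChart T hpq hx y).linear)
      (B := (C.adaptedChart T hpq hx y').linear) hinj
      (C.adaptedChart T hpq hx y').linear_injective (by
        rw [LinearMap.range_comp, (C.adaptedChart T hpq hx y).range_linear,
          (C.adaptedChart T hpq hx y').range_linear, ← h1, ← h2, orbitSpace_map hi hj hg])
    refine ⟨h, ?_⟩
    filter_upwards [(C.orbitChart T hpq hx y).open_source.mem_nhds hz,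
      (C.orbitChart T hpq hx y').open_source.mem_nhds hz',
      (C.orbitPlaques T hpq hx).contMDiff_incl.continuous.continuousAt.eventually hg]
      with w hw hw' hwg
    rw [map_eq_act]
    refine act_injective (C.adaptedChart T hpq hx y').linear_injective ?_
    rw [← chart_incl hw', hwg, chart_incl hw, ← act_comp_of_injective _ h.injective,
      ← act_comp_of_injective _ (C.adaptedChart T hpq hx y).linear_injective]
    congr 1
    exact LinearMap.ext fun v => (hh v).symm

theorem isProjectiveMap_incl :
    IsProjectiveMap (C.orbitProjectiveStructure T hpq hx) P (C.orbitPlaques T hpq hx).incl := by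
  refine IsProjectiveMap.of_exists (C.orbitPlaques T hpq hx).contMDiff_incl fun z => ?_
  set y : P.orbit x := ⟨_, (C.orbitPlaques T hpq hx).incl_mem z⟩
  have hz : z ∈ (C.orbitChart T hpq hx y).source :=
    mem_orbitChart_source.2 ((C.orbitPlaques T hpq hx).mem_plaque_self y)
  refine ⟨_, mem_range_self y, hz, _, C.chart_mem (C.adaptedChart T hpq hx y).idx,
    C.piece_subset _ (C.adaptedChart T hpq hx y).mem_piece, _,
    (C.adaptedChart T hpq hx y).linear_injective, ?_⟩
  filter_upwards [(C.orbitChart T hpq hx y).open_source.mem_nhds hz] with w hw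
  exact chart_incl hw

end Orbit

end GoodCover

/-! ### Vector fields tangent to the orbits -/

namespace RealProj

theorem homog_smul (t : ℝ) (w : EuclideanSpace ℝ (Fin n)) :
    homog 0 (t • w) = homog 0 0 + t • (homog 0 w - homog 0 0) := by
  ext k
  rcases Fin.eq_self_or_eq_succAbove 0 k with rfl | ⟨j, rfl⟩
  · simp only [Pi.add_apply, Pi.smul_apply, Pi.sub_apply, homog_self]
    simp
  · simp only [Pi.add_apply, Pi.smul_apply, Pi.sub_apply, homog_succAbove]
    simp

end RealProj

namespace GoodCover

variable {P : ProjectiveStructure n M} {C : GoodCover P}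

variable (C) in
/-- A curve `s ↦ 1 + fn s • a` in the algebra, with velocity `a` at `0`, which stays so close to `1`
that it defines diffeomorphisms preserving the orbits. -/
structure SymmetryCurve (a : C.symAlg) where
  /-- the reparametrization of the line -/
  fn : ℝ → ℝ
  contDiff : ContDiff ℝ ∞ fn
  fn_zero : fn 0 = 0
  hasDerivAt : HasDerivAt fn 1 0
  integrable : ∀ s, C.Integrable (1 + fn s • a)
  mem_orbit : ∀ s x, C.toMap (1 + fn s • a) x ∈ P.orbit x

theorem tendsto_one_add_smul (a : C.symAlg) :
    Tendsto (fun t : ℝ => 1 + t • a) (𝓝 0) (𝓝 (1 : C.symAlg)) := by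
  have h : Continuous fun t : ℝ => 1 + t • a :=
    continuous_const.add (continuous_id.smul continuous_const)
  simpa using h.tendsto 0

theorem nonempty_symmetryCurve [CompactSpace M] (a : C.symAlg) :
    Nonempty (C.SymmetryCurve a) := by
  obtain ⟨ε, hε, h⟩ := Metric.nhds_basis_closedBall.eventually_iff.1
    ((tendsto_one_add_smul a).eventually
      (C.eventually_integrable.and C.eventually_toMap_mem_orbit))
  -- a smooth function with values in `[-ε, ε]`
  have hb : ∀ s : ℝ, ε * Real.sin (s / ε) ∈ Metric.closedBall (0 : ℝ) ε := fun s => by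
    rw [mem_closedBall_zero_iff, Real.norm_eq_abs, abs_mul, abs_of_pos hε]
    exact mul_le_of_le_one_right hε.le (Real.abs_sin_le_one _)
  exact ⟨{
    fn := fun s => ε * Real.sin (s / ε)
    contDiff := contDiff_const.mul (Real.contDiff_sin.comp (contDiff_id.div_const ε))
    fn_zero := by simp
    hasDerivAt := by
      have := ((hasDerivAt_id (0 : ℝ)).div_const ε).sin.const_mul ε
      simpa [hε.ne'] using this
    integrable := fun s => (h (hb s)).1
    mem_orbit := fun s => (h (hb s)).2 }⟩

namespace SymmetryCurve

variable {a : C.symAlg} (c : C.SymmetryCurve a)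

/-- The family of diffeomorphisms of `M` defined by the curve. -/
def flow (s : ℝ) (x : M) : M := C.toMap (1 + c.fn s • a) x

theorem flow_zero (x : M) : c.flow 0 x = x := by
  rw [flow, c.fn_zero, zero_smul, add_zero, toMap_one]

theorem contMDiff_flow : ContMDiff (𝓘(ℝ, ℝ).prod (𝓡 n)) (𝓡 n) ∞
    fun q : ℝ × M => c.flow q.1 q.2 := by
  rintro ⟨s, x⟩
  obtain ⟨i, hi⟩ := C.cover x
  have hu : ContDiff ℝ ∞ fun s : ℝ =>
      (1 + c.fn s • a.1 i : (Fin (n + 1) → ℝ) →L[ℝ] (Fin (n + 1) → ℝ)) :=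
    contDiff_const.add (c.contDiff.smul contDiff_const)
  refine (Regular.contMDiffAt_localMap (i := i) (I := 𝓘(ℝ, ℝ).prod (𝓡 n))
    (u := fun q : ℝ × M => 1 + c.fn q.1 • a.1 i) (h := Prod.snd) (x := (s, x))
    (c.integrable s x i hi).1 (hu.contMDiff.comp contMDiff_fst).contMDiffAt
    contMDiffAt_snd).congr_of_eventuallyEq ?_
  filter_upwards [continuousAt_snd.eventually ((C.isOpen i).mem_nhds hi)] with q hq
  exact (c.integrable q.1 q.2 i hq).2

/-- The vector field of the initial velocities of the family. The velocity at `x` is a tangent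
vector at `c.flow 0 x`, which is equal to `x`, and all tangent spaces are the model space. -/
def field (x : M) : TangentSpace (𝓡 n) x :=
  (mfderiv 𝓘(ℝ, ℝ) (𝓡 n) (fun s => c.flow s x) 0 (1 : ℝ) : EuclideanSpace ℝ (Fin n))

theorem contMDiff_field [IsManifold (𝓡 n) ∞ M] : ContMDiff (𝓡 n) (𝓡 n).tangent ∞
    fun x => (⟨x, c.field x⟩ : TangentBundle (𝓡 n) M) := by
  have h1 : ContMDiff (𝓘(ℝ, ℝ).prod (𝓡 n)).tangent (𝓡 n).tangent ∞
      (tangentMap (𝓘(ℝ, ℝ).prod (𝓡 n)) (𝓡 n) fun q : ℝ × M => c.flow q.1 q.2) :=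
    c.contMDiff_flow.contMDiff_tangentMap (by simp)
  have h2 : ContMDiff (𝓡 n) (𝓡 n).tangent ∞
      fun x : M => (⟨x, 0⟩ : TangentBundle (𝓡 n) M) :=
    Bundle.contMDiff_zeroSection ℝ (TangentSpace (𝓡 n) : M → Type _)
  have h3 : ContMDiff (𝓡 n) (𝓘(ℝ, ℝ).prod (𝓡 n)).tangent ∞
      fun x : M => (equivTangentBundleProd 𝓘(ℝ, ℝ) ℝ (𝓡 n) M).symm
        ((⟨0, (1 : ℝ)⟩ : TangentBundle 𝓘(ℝ, ℝ) ℝ), (⟨x, 0⟩ : TangentBundle (𝓡 n) M)) :=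
    contMDiff_equivTangentBundleProd_symm.comp (contMDiff_const.prodMk h2)
  -- the field is the tangent map of the flow applied to the vectors `∂/∂s` at the points `(0, x)`
  have h4 : ∀ (x y : M) (_ : y = x) (v : EuclideanSpace ℝ (Fin n)),
      (⟨x, v⟩ : TangentBundle (𝓡 n) M) = ⟨y, v⟩ := by
    rintro _ _ rfl _
    rfl
  refine (h1.comp h3).congr fun x => ?_
  refine (h4 _ _ (c.flow_zero x) _).trans ?_
  have h5 := mfderiv_comp_apply (0 : ℝ) (I := 𝓘(ℝ, ℝ)) (I' := 𝓘(ℝ, ℝ).prod (𝓡 n)) (I'' := 𝓡 n)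
    (f := fun s : ℝ => (s, x)) (g := fun q : ℝ × M => c.flow q.1 q.2)
    ((c.contMDiff_flow _).mdifferentiableAt (by simp))
    ((contMDiffAt_id.prodMk contMDiffAt_const).mdifferentiableAt
      (by simp : (∞ : WithTop ℕ∞) ≠ 0)) (1 : ℝ)
  rw [mfderiv_prod_left] at h5
  exact congrArg (fun v => (⟨c.flow 0 x, v⟩ : TangentBundle (𝓡 n) M)) h5

end SymmetryCurve

section Orbit

variable [IsManifold (𝓡 n) ∞ M] [T2Space M] [CompactSpace M] {p q : ℕ}
  {T : (EuclideanSpace ℝ (Fin p) × EuclideanSpace ℝ (Fin q)) ≃L[ℝ] EuclideanSpace ℝ (Fin n)}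
  {hpq : p + q = n} {x : M} {hx : C.rank x = p + 1}

/-- The trajectories of the points of a leaf are smooth curves in the leaf. -/
theorem SymmetryCurve.field_incl_mem {a : C.symAlg} (c : C.SymmetryCurve a)
    (z : (C.orbitPlaques T hpq hx).Leaf) :
    c.field ((C.orbitPlaques T hpq hx).incl z) ∈
      range (mfderiv (𝓡 p) (𝓡 n) (C.orbitPlaques T hpq hx).incl z) := by
  let D := C.orbitPlaques T hpq hx
  let γ : ℝ → D.Leaf := fun s => D.toLeaf
    ⟨c.flow s (D.incl z), P.mem_orbit_trans (D.incl_mem z) (c.mem_orbit s _)⟩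
  have hγ0 : γ 0 = z := D.incl_injective (c.flow_zero _)
  let y : P.orbit x := ⟨D.incl z, D.incl_mem z⟩
  have h1 : ContMDiffAt 𝓘(ℝ, ℝ) (𝓡 n) ∞ (D.incl ∘ γ) 0 :=
    (c.contMDiff_flow.comp (contMDiff_id.prodMk contMDiff_const)).contMDiffAt
  have h2 : Tendsto (fun s => 1 + c.fn s • a) (𝓝 0) (𝓝 (1 : C.symAlg)) := by
    refine (tendsto_one_add_smul a).comp ?_
    have := c.contDiff.continuous.tendsto 0
    rwa [c.fn_zero] at this
  have h3 : ContMDiffAt 𝓘(ℝ, ℝ) (𝓡 p) ∞ γ 0 := by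
    refine PlaqueFamily.contMDiffAt_of_plaque (x := y) h1 ?_
      (h2.eventually (C.eventually_toMap_mem_plaque T hpq hx y))
    rw [hγ0]
    exact D.mem_plaque_self y
  have h4 := mfderiv_comp_apply_of_eq (0 : ℝ) (I := 𝓘(ℝ, ℝ)) (I' := 𝓡 p) (I'' := 𝓡 n)
    (f := γ) (g := D.incl) (y := z)
    ((D.contMDiff_incl z).mdifferentiableAt (by simp)) (h3.mdifferentiableAt (by simp)) hγ0
    (1 : ℝ)
  exact ⟨_, h4.symm⟩

/-- In the linear parametrization of a plaque by the lines spanned by the vectors `L (1, t)`, the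
section `a` with `a v = L (1, w) - v`, where `v = L (1, 0)`, satisfies `(1 + s a) v = L (1, s w)`,
so it moves the center of the plaque with velocity `w`. -/
theorem exists_field_incl_eq (z : (C.orbitPlaques T hpq hx).Leaf) (w : TangentSpace (𝓡 p) z) :
    ∃ a : C.symAlg, ∀ c : C.SymmetryCurve a, c.field ((C.orbitPlaques T hpq hx).incl z) =
      mfderiv (𝓡 p) (𝓡 n) (C.orbitPlaques T hpq hx).incl z w := by
  let D := C.orbitPlaques T hpq hx
  let y : P.orbit x := ⟨D.incl z, D.incl_mem z⟩
  let A := C.adaptedChart T hpq hx y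
  have hy := D.mem_plaque_self y
  have hcoord : D.coord y y.1 = 0 := by
    change (T.symm (A.chart y)).1 = 0
    rw [A.chart_self]
    simp
  have htarget : D.split ((0 : EuclideanSpace ℝ (Fin p)), 0) ∈ (D.chart y).target := by
    rw [← hcoord, PlaqueFamily.split_coord hy]
    exact (D.chart y).map_source hy.1
  have hparam : MDifferentiableAt (𝓡 p) (𝓡 n) (D.param y) 0 :=
    (PlaqueFamily.contMDiffAt_param htarget).mdifferentiableAt (by simp)
  have hφ : MDifferentiableAt (𝓡 p) (𝓡 p) (fun z => D.coord y (D.incl z)) z :=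
    (ContMDiffAt.comp z (PlaqueFamily.contMDiffAt_coord hy.1)
      (D.contMDiff_incl z)).mdifferentiableAt (by simp)
  let w' : EuclideanSpace ℝ (Fin p) := mfderiv (𝓡 p) (𝓡 p) (fun z => D.coord y (D.incl z)) z w
  have h1 : mfderiv (𝓡 p) (𝓡 n) D.incl z w = mfderiv (𝓡 p) (𝓡 n) (D.param y) 0 w' := by
    have h2 : D.incl =ᶠ[𝓝 z] D.param y ∘ fun z => D.coord y (D.incl z) := by
      filter_upwards [(D.leafChart y).open_source.mem_nhds hy] with z' hz'
      exact (PlaqueFamily.param_coord hz').symm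
    rw [h2.mfderiv_eq]
    exact mfderiv_comp_apply_of_eq z hparam hφ hcoord w
  obtain ⟨a, ha⟩ : A.linear (homog 0 w') - (C.chart A.idx y).rep ∈ C.orbitSpace A.idx y := by
    refine Submodule.sub_mem _ ?_ (self_mem_vecSpace _ _)
    rw [← A.range_linear]
    exact LinearMap.mem_range_self _ _
  replace ha : a.1 A.idx (C.chart A.idx y).rep =
    A.linear (homog 0 w') - (C.chart A.idx y).rep := ha
  refine ⟨a, fun c => ?_⟩
  have hev : (fun s => c.flow s (D.incl z)) =ᶠ[𝓝 0] D.param y ∘ fun s => c.fn s • w' := by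
    have h2 : Tendsto (fun s => c.fn s • w') (𝓝 0) (𝓝 0) := by
      have := (c.contDiff.continuous.tendsto 0).smul_const w'
      rwa [c.fn_zero, zero_smul] at this
    filter_upwards [h2.eventually ((D.isOpen_paramTarget y).mem_nhds htarget)] with s hs
    have k1 := PlaqueFamily.param_mem_plaque hs
    refine (C.chart A.idx).injOn ((c.integrable s).toMap_mem A.mem_piece)
      (C.piece_subset _ (A.source_subset k1.1)) ?_
    have k2 := A.chart_eq _ k1.1 k1.2
    have k3 : (T.symm (A.chart (D.param y (c.fn s • w')))).1 = c.fn s • w' :=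
      PlaqueFamily.coord_param hs
    rw [k3] at k2
    refine Eq.trans ?_ k2.symm
    refine ((c.integrable s).chart_toMap A.mem_piece).trans ?_
    rw [← proj_rep (C.chart A.idx y), act_proj _ (Projectivization.rep_nonzero _), homog_smul,
      map_add, map_smul, map_sub, A.linear_homog, ← ha]
    rfl
  have hs : HasDerivAt (fun s => c.fn s • w') w' 0 := by
    simpa using c.hasDerivAt.smul_const w'
  have h5 : (mfderiv 𝓘(ℝ, ℝ) (𝓡 p) (fun s => c.fn s • w') 0 (1 : ℝ) :
      EuclideanSpace ℝ (Fin p)) = w' := by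
    rw [mfderiv_eq_fderiv, hs.hasFDerivAt.fderiv]
    exact one_smul ℝ w'
  have h6 := mfderiv_comp_apply_of_eq (0 : ℝ) (I := 𝓘(ℝ, ℝ)) (I' := 𝓡 p) (I'' := 𝓡 n)
    (g := D.param y) (y := (0 : EuclideanSpace ℝ (Fin p))) hparam
    hs.differentiableAt.mdifferentiableAt (by simp [c.fn_zero]) (1 : ℝ)
  refine Eq.trans ?_ h1.symm
  rw [SymmetryCurve.field, hev.mfderiv_eq]
  refine h6.trans ?_
  exact congrArg (mfderiv (𝓡 p) (𝓡 n) (D.param y) 0) h5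

end Orbit

/-- The orbits are immersed projective submanifolds, whose tangent spaces are spanned by the vector
fields defined by the curves in the algebra. -/
theorem exists_immersedSubmanifold [IsManifold (𝓡 n) ∞ M] [T2Space M] [CompactSpace M]
    (C : GoodCover P) (x : M) : ∃ S : ImmersedSubmanifold n M,
      S.support = P.orbit x ∧ ConnectedSpace S.Carrier ∧ S.IsProjective P ∧
      (∀ (a : C.symAlg) (c : C.SymmetryCurve a) (z : S.Carrier),
        c.field (S.incl z) ∈ range (mfderiv (𝓡 S.dim) (𝓡 n) S.incl z)) ∧
      ∀ (z : S.Carrier) (w : TangentSpace (𝓡 S.dim) z), ∃ a : C.symAlg,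
        ∀ c : C.SymmetryCurve a, c.field (S.incl z) = mfderiv (𝓡 S.dim) (𝓡 n) S.incl z w := by
  obtain ⟨p, hp⟩ : ∃ p, C.rank x = p + 1 := Nat.exists_eq_succ_of_ne_zero (rank_pos x).ne'
  obtain ⟨q, hpq⟩ : ∃ q, p + q = n := by
    have := rank_le (C := C) x
    exact ⟨n - p, by omega⟩
  have T : (EuclideanSpace ℝ (Fin p) × EuclideanSpace ℝ (Fin q)) ≃L[ℝ] EuclideanSpace ℝ (Fin n) :=
    ContinuousLinearEquiv.ofFinrankEq (by simp [hpq])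
  have := C.secondCountableTopology_orbit T hpq hp
  exact ⟨{
      dim := p
      Carrier := (C.orbitPlaques T hpq hp).Leaf
      incl := (C.orbitPlaques T hpq hp).incl
      injective := (C.orbitPlaques T hpq hp).incl_injective
      isImmersion := (C.orbitPlaques T hpq hp).isImmersion_incl },
    (C.orbitPlaques T hpq hp).range_incl, C.connectedSpace_orbit T hpq hp,
    ⟨_, C.isProjectiveMap_incl T hpq hp⟩, fun _ c z => c.field_incl_mem z,
    exists_field_incl_eq⟩

end GoodCover

theorem ProjectiveStructure.orbit_eq_of_mem {P : ProjectiveStructure n M} {x y : M}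
    (h : y ∈ P.orbit x) : P.orbit y = P.orbit x :=
  Subset.antisymm (fun _ hz => P.mem_orbit_trans h hz)
    fun _ hz => P.mem_orbit_trans (P.mem_orbit_symm h) hz

end

end

theorem proposition4p1 (n : ℕ) (M : Type*) [TopologicalSpace M] [T2Space M] [CompactSpace M]
    [ChartedSpace (EuclideanSpace ℝ (Fin n)) M] [IsManifold (𝓡 n) ∞ M]
    (P : ProjectiveStructure n M) :
    ∃ 𝓕 : SingularFoliation n M,
      ImmersedSubmanifold.support '' 𝓕.leaves = range P.orbit ∧
      ∀ S ∈ 𝓕.leaves, S.IsProjective P := by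
  obtain ⟨C⟩ := GoodCover.exists_of_compact P
  -- one leaf for each orbit, not one for each point
  have key : ∀ O : range P.orbit, ∃ S : ImmersedSubmanifold n M,
      S.support = O ∧ ConnectedSpace S.Carrier ∧ S.IsProjective P ∧
      (∀ (a : C.symAlg) (c : C.SymmetryCurve a) (z : S.Carrier),
        c.field (S.incl z) ∈ range (mfderiv (𝓡 S.dim) (𝓡 n) S.incl z)) ∧
      ∀ (z : S.Carrier) (w : TangentSpace (𝓡 S.dim) z), ∃ a : C.symAlg,
        ∀ c : C.SymmetryCurve a, c.field (S.incl z) = mfderiv (𝓡 S.dim) (𝓡 n) S.incl z w := by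
    rintro ⟨_, x, rfl⟩
    exact C.exists_immersedSubmanifold x
  choose S hsupp hconn hproj htan hsurj using key
  refine ⟨{
    leaves := range S
    connected := by
      rintro _ ⟨O, rfl⟩
      exact hconn O
    cover := fun x => ⟨_, mem_range_self ⟨_, mem_range_self x⟩, by
      rw [hsupp]
      exact P.mem_orbit_self x⟩
    disjoint := by
      rintro _ ⟨O, rfl⟩ _ ⟨O', rfl⟩ hne
      refine disjoint_left.2 fun z hz hz' => hne ?_
      rw [hsupp] at hz hz'
      obtain ⟨_, x, rfl⟩ := O
      obtain ⟨_, x', rfl⟩ := O'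
      exact congrArg S (Subtype.ext
        ((P.orbit_eq_of_mem hz).symm.trans (P.orbit_eq_of_mem hz')))
    exists_vectorField := by
      rintro _ ⟨O, rfl⟩ y w
      obtain ⟨a, ha⟩ := hsurj O y w
      obtain ⟨c⟩ := GoodCover.nonempty_symmetryCurve a
      refine ⟨c.field, c.contMDiff_field, ?_, ha c⟩
      rintro _ ⟨O', rfl⟩ z
      exact htan O' a c z }, ?_, ?_⟩
  · change ImmersedSubmanifold.support '' range S = _
    rw [← range_comp]
    ext O
    constructor
    · rintro ⟨O', rfl⟩
      rw [Function.comp_apply, hsupp]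
      exact O'.2
    · exact fun hO => ⟨⟨O, hO⟩, hsupp _⟩
  · rintro _ ⟨O, rfl⟩
    exact hproj O
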